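/- Let $n\in\mathbb N$ and let $\mathbf u=\langle u_0,\dots,u_{k-1}\rangle$ be a finite sequence of transpositions in $\mathrm{Sym}(n)$, the symmetric group on $\{0,\dots,n-1\}$; write $|\mathbf u|=k$. Let $\mathrm{Prod}(\mathbf u)\subseteq \mathrm{Sym}(n)$ be the set of all products $r_0\circ r_1\circ\cdots\circ r_{k-1}$ over all rearrangements $\langle r_0,\dots,r_{k-1}\rangle$ of $\mathbf u$. Call $\mathbf u$ *conjugacy invariant* (CI) if every element of $\mathrm{Prod}(\mathbf u)$ is conjugate in $\mathrm{Sym}(n)$ to $u_0\circ u_1\circ\cdots\circ u_{k-1}$, and *perm-complete* if $\mathrm{Prod}(\mathbf u)$ is $\mathrm{Alt}(n)$ or $\mathrm{Sym}(n)\setminus\mathrm{Alt}(n)$. Let $\mathcal T(\mathbf u)$ be the multigraph on the vertex set $\{0,\dots,n-1\}$ in which the multiplicity of a pair $(x\,y)$ of distinct vertices is the number of times that the transposition $(x\,y)$ occurs as a term of $\mathbf u$. A *multiedge* is a pair of positive multiplicity; it is *simple* if its multiplicity is $1$ and *non-simple* if its multiplicity is at least $2$. Two vertices are *neighbours* if they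 form a multiedge. A multigraph is connected, respectively a *multitree*, if the simple graph formed by its multiedges is connected, respectively a tree. A *multitwig* is a multiedge $(v\,w)$ such that $w$ is the only neighbour of $v$; then $v$ is its *leaf* and $w$ its *non-leaf vertex*. Call a multigraph *good* if it is a multitree such that no vertex lies on more than one non-simple multiedge, and such that every multiedge of even multiplicity is a multitwig whose non-leaf vertex has exactly two neighbours. **(A) Connected case.** Suppose that $\mathcal T(\mathbf u)$ is connected. 1. If $n=2$, then $\mathbf u$ is both perm-complete and CI. 2. If $n=3$, then $\mathbf u$ is CI if and only if $|\mathbf u|$ is odd or $\mathcal T(\mathbf u)$ is a multitree with at least one simple multiedge. 3. If $n\ge4$, then $\mathbf u$ is CI if and only if $\mathcal T(\mathbf u)$ is good. **(B) General case.** Suppose that $n\ge3$ ($\mathcal T(\mathbf u)$ need not be connected). Let $V_i$ $(i\in I)$ be the vertex sets of the connected components of $\mathcal T(\mathbf u)$, isolated vertices included, and for each $i$ let $\mathbf u_i$ be the subsequence of $\mathbf u$ consisting of the terms whose support is contained in $V_i$. Regard $\mathbf u_i$ as a sequence in $\mathrm{Sym}(n)$ and $\mathcal T(\mathbf u_i)$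 as a multigraph on the vertex set $V_i$. 1. $\mathbf u$ is CI if and only if $\mathbf u_i$ is CI for every $i\in I$. 2. If $|V_i|=3$, then $\mathbf u_i$ is CI if and only if $|\mathbf u_i|$ is odd or $\mathcal T(\mathbf u_i)$ is a multitree with a simple multitwig. 3. If $|V_i|\ge4$, then $\mathbf u_i$ is CI if and only if $\mathcal T(\mathbf u_i)$ is good. -/

import Mathlib

/-! ## Sequences of permutations -/

namespace PermSeq

variable {α : Type*}

/-- The compositional product `s₀ ∘ s₁ ∘ ⋯ ∘ sₖ₋₁` of a finite sequence of permutations, composed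
from left to right: `s₀` acts first. The empty product is the identity. -/
def comp (s : List (Equiv.Perm α)) : Equiv.Perm α :=
  s.foldr (fun f g => f.trans g) (Equiv.refl α)

/-- `Seq(s)`: the set of all rearrangements of the terms of `s`. -/
def rearrangements (s : List (Equiv.Perm α)) : Set (List (Equiv.Perm α)) :=
  {r | r.Perm s}

/-- `Prod(s)`: the set of all products of rearrangements of `s`. -/
def prodSet (s : List (Equiv.Perm α)) : Set (Equiv.Perm α) :=
  comp '' rearrangements s

/-- `s` is conjugacy invariant (CI): every element of `Prod(s)` is conjugate, in the full
symmetric group, to the product of `s`. -/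
def ConjInvariant (s : List (Equiv.Perm α)) : Prop :=
  ∀ g ∈ prodSet s, IsConj (comp s) g

/-- `s` is permutationally complete: `Prod(s)` is the alternating group or its complement. -/
def PermComplete [Fintype α] [DecidableEq α] (s : List (Equiv.Perm α)) : Prop :=
  prodSet s = (alternatingGroup α : Set (Equiv.Perm α)) ∨
    prodSet s = (alternatingGroup α : Set (Equiv.Perm α))ᶜ

/-- `s` is a transpositional sequence: each of its terms is a transposition. -/
def Transpositional [DecidableEq α] (s : List (Equiv.Perm α)) : Prop :=
  ∀ t ∈ s, t.IsSwap

open Classical in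
/-- The subsequence of `s` of those terms whose support is contained in `S`. -/
noncomputable def restrictTo (s : List (Equiv.Perm α)) (S : Set α) : List (Equiv.Perm α) :=
  s.filter (fun t => decide ({x | t x ≠ x} ⊆ S))

end PermSeq

/-! ## Loopless multigraphs -/

/-- A loopless multigraph on the vertex set `V`, with finite multiplicities: the pair `(x y)` is
joined by a bundle of `mult x y` simple edges. -/
structure LooplessMultigraph (V : Type*) where
  mult : V → V → ℕ
  symm : ∀ x y, mult x y = mult y x
  loopless : ∀ x, mult x x = 0

namespace LooplessMultigraph

variable {V : Type*} (G : LooplessMultigraph V)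

/-- `(x y)` is a multiedge of `G`: its multiplicity is positive. -/
def IsMultiedge (x y : V) : Prop := 0 < G.mult x y

/-- `(x y)` is a simple multiedge: its multiplicity is one. -/
def IsSimpleMultiedge (x y : V) : Prop := G.mult x y = 1

/-- `(x y)` is a non-simple multiedge: its multiplicity is at least two. -/
def IsNonsimpleMultiedge (x y : V) : Prop := 2 ≤ G.mult x y

/-- The simple graph underlying a multigraph. -/
def toSimpleGraph : SimpleGraph V where
  Adj x y := G.IsMultiedge x y
  symm := ⟨fun x y h => by
    have h' : 0 < G.mult x y := h
    rw [G.symm] at h'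
    exact h'⟩
  loopless := ⟨fun x h => by
    have h' : 0 < G.mult x x := h
    rw [G.loopless] at h'
    exact absurd h' (lt_irrefl 0)⟩

/-- A multigraph is connected if its underlying simple graph is. -/
def Connected : Prop := G.toSimpleGraph.Connected

/-- A multitree: the underlying simple graph is a tree (connected and without circuits). -/
def IsMultitree : Prop := G.toSimpleGraph.IsTree

/-- The set of neighbours of a vertex. -/
def neighbors (v : V) : Set V := {w | G.IsMultiedge v w}

/-- `(v w)` is a multitwig with leaf `v` (and non-leaf vertex `w`): it is a multiedge, and `w` is
the only neighbour of `v`. -/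
def IsMultitwig (v w : V) : Prop := G.neighbors v = {w}

/-- The submultigraph induced on a set of vertices. -/
def induce (S : Set V) : LooplessMultigraph S where
  mult x y := G.mult x y
  symm x y := G.symm x y
  loopless x := G.loopless x

/-- No vertex lies on more than one non-simple multiedge. -/
def NonsimpleDisjoint : Prop :=
  ∀ v x y, G.IsNonsimpleMultiedge v x → G.IsNonsimpleMultiedge v y → x = y

/-- Each multiedge of (positive) even multiplicity is a multitwig whose non-leaf vertex has exactly
two neighbours. -/
def EvenMultiedgesAreTwigs : Prop :=
  ∀ x y, G.IsMultiedge x y → Even (G.mult x y) →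
    (G.IsMultitwig x y ∧ (G.neighbors y).ncard = 2) ∨
    (G.IsMultitwig y x ∧ (G.neighbors x).ncard = 2)

end LooplessMultigraph

/-- The transpositional multigraph `T(u)`: the multiplicity of `(x y)` is the number of times that
the transposition `(x y)` occurs as a term of `u`. -/
def transpositionalMultigraph {α : Type*} [Fintype α] [DecidableEq α]
    (u : List (Equiv.Perm α)) : LooplessMultigraph α where
  mult x y := if x = y then 0 else u.count (Equiv.swap x y)
  symm x y := by simp only [eq_comm (a := x), Equiv.swap_comm x y]
  loopless x := if_pos rfl

/-! Conjugacy is tested through one class function, `cyclePairs`, the sum of the squared cycle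
lengths. If chosen points lie on distinct cycles of `q`, then multiplying `q` by a permutation `g`
of these points glues the `q`-cycles together in the pattern of the cycles of `g`
(`sameCycle_mul_viaEmbedding_iff`). So `cyclePairs` becomes a constant plus a sum of positive
weights over the pairs on a common cycle of `g`. Every permutation is such a `q` times a permutation
`h` of the chosen points (`exists_eq_mul_viaEmbedding`). Whether a few terms on three or four
vertices violate CI, whatever the other terms are, thus becomes a finite question about `h`: a
termwise comparison of same-cycle relations gives a strict inequality for all weights at once
(`Refuted`).

Necessity for at least four vertices. The finite checks say that three edges at a vertex force their
four vertices onto distinct cycles of every product of the remaining terms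
(`ConjInvariant.not_sameCycle_of_star`), and they exclude a few other configurations outright.
Against this stand three sources of freedom: pairs of equal terms may be cancelled
(`ConjInvariant.of_count_le`); the terms along a path can be ordered so that its ends share a cycle
(`exists_perm_sameCycle_of_path`); cycles of a product stay inside the components of the multigraph
(`reachable_of_sameCycle_prod`). Together they rule out circuits, touching non-simple multiedges and
badly placed even multiedges.

Sufficiency. A multiedge of even multiplicity in a good multigraph fails to commute with only one
other term. Rotating that term to the end, a conjugation, lets the even multiedge cancel
(`exists_isConj_prod_odd`). What remains is a forest of odd multiplicities, and the cycles of its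
product are exactly its components in any order (`sameCycle_prod_iff_reachable`); the partition into
cycles determines the conjugacy class.

On three vertices parity decides: odd products are transpositions, and even ones are settled by two
more finite checks. In general, terms from different components are disjoint, so cycle types add and
each component can be treated on its own vertex set. -/

open Equiv

/-! ### Orbits of a permutation and transport along an embedding -/

section SameCycle

variable {V : Type*}

/-- On a finite type natural powers already sweep out a cycle, so forward invariance suffices. -/
theorem Equiv.Perm.SameCycle.mem_of_mapsTo [Finite V] {g : Perm V} {S : Set V}
    (hS : Set.MapsTo g S S) {x y : V} (h : g.SameCycle x y) (hx : x ∈ S) : y ∈ S := by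
  obtain ⟨k, rfl⟩ := h.exists_nat_pow_eq
  clear h
  induction k with
  | zero => simpa
  | succ k ih => rw [pow_succ', Perm.mul_apply]; exact hS ih

theorem Equiv.Perm.SameCycle.of_forall [Finite V] {g : Perm V} {r : V → V → Prop}
    (hr : Equivalence r)
    (h : ∀ x, r x (g x)) {x y : V} (hxy : g.SameCycle x y) : r x y :=
  hxy.mem_of_mapsTo (S := {z | r x z}) (fun z hz => hr.trans hz (h z)) (hr.refl x)

theorem Equiv.Perm.viaEmbedding_swap {ι : Type*} [DecidableEq ι] [DecidableEq V] (f : ι ↪ V)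
    (i j : ι) :
    (swap i j).viaEmbedding f = swap (f i) (f j) := by
  ext x
  by_cases hx : x ∈ Set.range f
  · obtain ⟨k, rfl⟩ := hx
    rw [Perm.viaEmbedding_apply]
    exact (f.injective.swap_apply i j k).symm
  · rw [Perm.viaEmbedding_apply_of_notMem _ _ _ hx, swap_apply_of_ne_of_ne] <;>
    · rintro rfl; exact hx ⟨_, rfl⟩

end SameCycle

/-! ### Gluing cycles along a permutation of representatives -/

section BlowUp

variable {V ι : Type*} [Finite V]

/-- The new permutation agrees with `q` off the range of `f` and sends `f (g.symm i)` to `q (f i)`.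
From there it follows the `q`-cycle of `f i`, and the only point of the range it can meet is `f i`
itself. -/
theorem sameCycle_mul_viaEmbedding_of_sameCycle (f : ι ↪ V) {q : Perm V}
    (hq : ∀ i j, q.SameCycle (f i) (f j) → i = j) (g : Perm ι) {i : ι} {x : V}
    (h : q.SameCycle (f i) x) :
    (q * g.viaEmbedding f).SameCycle (f (g.symm i)) x := by
  set Q := q * g.viaEmbedding f with hQ
  have hQf : ∀ j, Q (f j) = q (f (g j)) := fun j => by
    simp [hQ, Perm.viaEmbedding_apply]
  have key : ∀ k : ℕ, Q.SameCycle (f (g.symm i)) ((q ^ (k + 1)) (f i)) := by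
    intro k
    induction k with
    | zero =>
      have := hQf (g.symm i)
      rw [Equiv.apply_symm_apply] at this
      rw [zero_add, pow_one, ← this]
      exact (Perm.sameCycle_apply_right).2 (Perm.SameCycle.refl _ _)
    | succ k ih =>
      by_cases hm : (q ^ (k + 1)) (f i) ∈ Set.range f
      · obtain ⟨j, hj⟩ := hm
        have hij : i = j := hq i j ⟨(k + 1 : ℕ), by rw [zpow_natCast, hj]⟩
        subst hij
        have := hQf (g.symm i)
        rw [Equiv.apply_symm_apply] at this
        rw [pow_succ', Perm.mul_apply, ← hj, ← this]
        exact (Perm.sameCycle_apply_right).2 (Perm.SameCycle.refl _ _)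
      · have : Q ((q ^ (k + 1)) (f i)) = (q ^ (k + 1 + 1)) (f i) := by
          rw [hQ, Perm.mul_apply, Perm.viaEmbedding_apply_of_notMem _ _ _ hm, pow_succ' q (k + 1),
            Perm.mul_apply]
        rw [← this]
        exact (Perm.sameCycle_apply_right).2 ih
  obtain ⟨k, hk⟩ := h.exists_nat_pow_eq
  rcases k with _ | k
  -- Here `x = f i`, while `key` treats positive exponents only; a positive return time of `f i`
  -- replaces the exponent zero.
  · obtain ⟨m, hm, hm'⟩ := (Perm.SameCycle.refl q (f i)).exists_pow_eq''
    have := key (m - 1)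
    rw [show m - 1 + 1 = m by omega] at this
    rw [← hk]
    rw [hm'.2] at this
    simpa using this
  · rw [← hk]; exact key k

/-- The union of the `q`-cycles attached to one cycle of `g` is invariant under the product, and the
product runs through all of it. -/
theorem sameCycle_mul_viaEmbedding_iff (f : ι ↪ V) {q : Perm V}
    (hq : ∀ i j, q.SameCycle (f i) (f j) → i = j) (g : Perm ι) {i j : ι} {x y : V}
    (hx : q.SameCycle (f i) x)
    (hy : q.SameCycle (f j) y) :
    (q * g.viaEmbedding f).SameCycle x y ↔ g.SameCycle i j := by
  set Q := q * g.viaEmbedding f with hQ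
  have h1 : ∀ k, Q.SameCycle (f k) (f (g k)) := fun k => by
    have := sameCycle_mul_viaEmbedding_of_sameCycle f hq g (Perm.SameCycle.refl q (f (g k)))
    simpa using this
  have h2 : ∀ {k : ι} {z : V}, q.SameCycle (f k) z → Q.SameCycle (f k) z := fun {k z} hz => by
    have := sameCycle_mul_viaEmbedding_of_sameCycle f hq g hz
    have h3 := h1 (g.symm k)
    rw [Equiv.apply_symm_apply] at h3
    exact h3.symm.trans this
  constructor
  · intro h
    have hmaps : Set.MapsTo Q {z | ∃ k, g.SameCycle i k ∧ q.SameCycle (f k) z}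
        {z | ∃ k, g.SameCycle i k ∧ q.SameCycle (f k) z} := by
      rintro z ⟨k, hk, hz⟩
      by_cases hm : z ∈ Set.range f
      · obtain ⟨m, rfl⟩ := hm
        obtain rfl := hq _ _ hz
        refine ⟨g k, Perm.sameCycle_apply_right.2 hk, ?_⟩
        rw [hQ, Perm.mul_apply, Perm.viaEmbedding_apply]
        exact (Perm.sameCycle_apply_right).2 (Perm.SameCycle.refl _ _)
      · refine ⟨k, hk, ?_⟩
        rw [hQ, Perm.mul_apply, Perm.viaEmbedding_apply_of_notMem _ _ _ hm]
        exact Perm.sameCycle_apply_right.2 hz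
    obtain ⟨k, hk, hky⟩ := h.mem_of_mapsTo hmaps ⟨i, Perm.SameCycle.refl _ _, hx⟩
    rwa [hq j k (hy.trans hky.symm)]
  · intro h
    have : Finite ι := Finite.of_injective f f.injective
    have h3 : Q.SameCycle (f i) (f j) :=
      h.of_forall (r := fun a b => Q.SameCycle (f a) (f b))
        ⟨fun _ => Perm.SameCycle.refl _ _, fun h => Perm.SameCycle.symm h,
          fun h h' => Perm.SameCycle.trans h h'⟩ h1
    exact ((h2 hx).symm.trans h3).trans (h2 hy)

theorem sameCycle_mul_viaEmbedding_iff_of_not (f : ι ↪ V) {q : Perm V} (g : Perm ι) {x y : V}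
    (hx : ∀ i, ¬ q.SameCycle (f i) x) :
    (q * g.viaEmbedding f).SameCycle x y ↔ q.SameCycle x y := by
  have h1 : ∀ {z}, (∀ i, ¬ q.SameCycle (f i) z) → (q * g.viaEmbedding f) z = q z :=
      fun {z} hz => by
    rw [Perm.mul_apply, Perm.viaEmbedding_apply_of_notMem _ _ _]
    rintro ⟨i, rfl⟩
    exact hz i (Perm.SameCycle.refl _ _)
  constructor
  · intro h
    refine (h.mem_of_mapsTo (S := {z | q.SameCycle x z}) ?_ (Perm.SameCycle.refl _ _))
    intro z hz
    rw [h1 fun i hi => hx i (hi.trans (Perm.SameCycle.symm hz))]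
    exact Perm.sameCycle_apply_right.2 hz
  · intro h
    refine (h.mem_of_mapsTo (S := {z | q.SameCycle x z ∧ (q * g.viaEmbedding f).SameCycle x z}) ?_
      ⟨Perm.SameCycle.refl _ _, Perm.SameCycle.refl _ _⟩).2
    rintro z ⟨hz, hz'⟩
    refine ⟨Perm.sameCycle_apply_right.2 hz, ?_⟩
    rw [← h1 fun i hi => hx i (hi.trans (Perm.SameCycle.symm hz))]
    exact Perm.sameCycle_apply_right.2 hz'

end BlowUp

/-! ### Counting pairs on a common cycle -/

section Weight

variable {V ι : Type*} [Fintype V] [Fintype ι]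

open Classical in
/-- The number of ordered pairs of points lying on a common cycle of `g`. -/
noncomputable def cyclePairs (g : Perm V) : ℕ :=
  (Finset.univ.filter fun p : V × V => g.SameCycle p.1 p.2).card

theorem cyclePairs_eq_of_isConj {g h : Perm V} (hgh : IsConj g h) :
    cyclePairs g = cyclePairs h := by
  classical
  obtain ⟨c, rfl⟩ := isConj_iff.1 hgh
  refine Finset.card_bij' (fun p _ => (c p.1, c p.2)) (fun p _ => (c⁻¹ p.1, c⁻¹ p.2)) ?_ ?_ ?_ ?_
  · simp [Perm.sameCycle_conj]
  · simp [Perm.sameCycle_conj]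
  · simp
  · simp

open Classical in
/-- The number of points on the cycle of `x`. -/
noncomputable def cycleLength (g : Perm V) (x : V) : ℕ :=
  (Finset.univ.filter fun y : V => g.SameCycle x y).card

theorem cycleLength_pos (g : Perm V) (x : V) : 0 < cycleLength g x := by
  classical
  exact Finset.card_pos.2 ⟨x, by simp [Perm.SameCycle.refl]⟩

open Classical in
-- Cycles of `q` that miss the range of `f` are unchanged and give the first summand. The other
-- pairs form disjoint products of two `q`-cycles, one product for each pair of indices on a common
-- cycle of `g`.
theorem cyclePairs_mul_viaEmbedding (f : ι ↪ V) {q : Perm V}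
    (hq : ∀ i j, q.SameCycle (f i) (f j) → i = j) (g : Perm ι) :
    cyclePairs (q * g.viaEmbedding f) =
      (Finset.univ.filter fun p : V × V =>
        (∀ i, ¬ q.SameCycle (f i) p.1) ∧ q.SameCycle p.1 p.2).card +
      ∑ p : ι × ι, if g.SameCycle p.1 p.2 then
        cycleLength q (f p.1) * cycleLength q (f p.2) else 0 := by
  rw [← Finset.sum_filter]
  have hB : ∑ p ∈ Finset.univ.filter fun p : ι × ι => g.SameCycle p.1 p.2,
      cycleLength q (f p.1) * cycleLength q (f p.2) =
      ((Finset.univ.filter fun p : ι × ι => g.SameCycle p.1 p.2).biUnion fun p =>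
        (Finset.univ.filter fun y : V => q.SameCycle (f p.1) y) ×ˢ
        (Finset.univ.filter fun y : V => q.SameCycle (f p.2) y)).card := by
    rw [Finset.card_biUnion]
    · simp [cycleLength]
    · rintro ⟨i, j⟩ - ⟨i', j'⟩ - hne
      rw [Function.onFun, Finset.disjoint_left]
      rintro ⟨x, y⟩ h1 h2
      simp only [Finset.mem_product, Finset.mem_filter, Finset.mem_univ, true_and] at h1 h2
      exact hne (Prod.ext (hq _ _ (h1.1.trans h2.1.symm)) (hq _ _ (h1.2.trans h2.2.symm)))
  rw [hB, ← Finset.card_union_of_disjoint]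
  · unfold cyclePairs
    congr 1
    ext ⟨x, y⟩
    simp only [Finset.mem_filter, Finset.mem_univ, true_and, Finset.mem_union, Finset.mem_biUnion,
      Finset.mem_product, Prod.exists]
    by_cases hx : ∀ i, ¬ q.SameCycle (f i) x
    · rw [sameCycle_mul_viaEmbedding_iff_of_not f g hx]
      simp [hx]
    · by_cases hy : ∀ j, ¬ q.SameCycle (f j) y
      · have : ¬ (q * g.viaEmbedding f).SameCycle x y := fun h => by
          rw [Perm.sameCycle_comm, sameCycle_mul_viaEmbedding_iff_of_not f g hy] at h
          push Not at hx
          obtain ⟨i, hi⟩ := hx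
          exact hy i (hi.trans h.symm)
        simp only [this, hx, false_and, false_or, false_iff, not_exists]
        rintro i j ⟨-, -, h⟩
        exact hy j h
      · push Not at hx hy
        obtain ⟨i, hi⟩ := hx
        obtain ⟨j, hj⟩ := hy
        rw [sameCycle_mul_viaEmbedding_iff f hq g hi hj]
        constructor
        · intro h; exact Or.inr ⟨i, j, h, hi, hj⟩
        · rintro (⟨h, -⟩ | ⟨i', j', h, hi', hj'⟩)
          · exact absurd hi (h i)
          · rwa [hq _ _ (hi.trans hi'.symm), hq _ _ (hj.trans hj'.symm)]
  · rw [Finset.disjoint_left]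
    rintro ⟨x, y⟩ h1 h2
    simp only [Finset.mem_filter, Finset.mem_univ, true_and, Finset.mem_biUnion,
      Finset.mem_product, Prod.exists] at h1 h2
    obtain ⟨i, j, -, h, -⟩ := h2
    exact h1.1 i h

end Weight

/-! ### Multiplication by one transposition, and factoring through chosen points -/

section Swap

variable {V : Type*} [DecidableEq V]

/-- The embedding of `Fin 2` with values `a` and `b`. -/
def pairEmbedding {a b : V} (h : a ≠ b) : Fin 2 ↪ V where
  toFun := ![a, b]
  inj' := by
    intro i j hij
    fin_cases i <;> fin_cases j <;> simp_all [eq_comm]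

/-- A transposition of points on two different cycles merges these cycles: the gluing principle for
two representatives. -/
theorem sameCycle_mul_swap_iff [Finite V] {p : Perm V} {a b : V} (h : ¬ p.SameCycle a b) (x y : V) :
    (p * swap a b).SameCycle x y ↔ p.SameCycle x y ∨
      ((p.SameCycle a x ∨ p.SameCycle b x) ∧ (p.SameCycle a y ∨ p.SameCycle b y)) := by
  have hab : a ≠ b := fun e => h (e ▸ Perm.SameCycle.refl _ _)
  have hq : ∀ i j, p.SameCycle (pairEmbedding hab i) (pairEmbedding hab j) → i = j := by
    intro i j
    fin_cases i <;> fin_cases j <;> intro hij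
    exacts [rfl, absurd hij h, absurd hij.symm h, rfl]
  have hs : swap a b = (swap (0 : Fin 2) 1).viaEmbedding (pairEmbedding hab) := by
    rw [Perm.viaEmbedding_swap]; rfl
  have hall : ∀ i j : Fin 2, (swap (0 : Fin 2) 1).SameCycle i j := by decide
  rw [hs]
  by_cases hx : p.SameCycle a x ∨ p.SameCycle b x
  · obtain ⟨i, hi⟩ : ∃ i, p.SameCycle (pairEmbedding hab i) x := by
      rcases hx with hx | hx
      exacts [⟨0, hx⟩, ⟨1, hx⟩]
    by_cases hy : p.SameCycle a y ∨ p.SameCycle b y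
    · obtain ⟨j, hj⟩ : ∃ j, p.SameCycle (pairEmbedding hab j) y := by
        rcases hy with hy | hy
        exacts [⟨0, hy⟩, ⟨1, hy⟩]
      rw [sameCycle_mul_viaEmbedding_iff _ hq _ hi hj]
      simp [hall, hx, hy]
    · have hy' : ∀ j, ¬ p.SameCycle (pairEmbedding hab j) y := by
        push Not at hy
        intro j
        fin_cases j
        exacts [hy.1, hy.2]
      rw [Perm.sameCycle_comm, sameCycle_mul_viaEmbedding_iff_of_not _ _ hy', Perm.sameCycle_comm]
      simp [hy]
  · have hx' : ∀ j, ¬ p.SameCycle (pairEmbedding hab j) x := by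
      push Not at hx
      intro j
      fin_cases j
      exacts [hx.1, hx.2]
    rw [sameCycle_mul_viaEmbedding_iff_of_not _ _ hx']
    simp [hx]

/-- Let `i` be the least positive exponent with `(p ^ i) a = b`. The arc `p a, …, (p ^ i) a` is
invariant under the product, which sends `b` back to `p a`, and the arc does not contain `a`. -/
theorem not_sameCycle_mul_swap [Finite V] {p : Perm V} {a b : V} (hab : a ≠ b)
    (h : p.SameCycle a b) : ¬ (p * swap a b).SameCycle a b := by
  classical
  obtain ⟨n, hn0, -, hn⟩ := h.exists_pow_eq''
  have hex : ∃ n, 0 < n ∧ (p ^ n) a = b := ⟨n, hn0, hn⟩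
  set i := Nat.find hex
  obtain ⟨hi0, hi⟩ : 0 < i ∧ (p ^ i) a = b := Nat.find_spec hex
  have hmin : ∀ m < i, 0 < m → (p ^ m) a ≠ b := fun m hm h0 h' => Nat.find_min hex hm ⟨h0, h'⟩
  intro hs
  have hmaps : Set.MapsTo (p * swap a b) {z | ∃ k, 0 < k ∧ k ≤ i ∧ (p ^ k) a = z}
      {z | ∃ k, 0 < k ∧ k ≤ i ∧ (p ^ k) a = z} := by
    rintro z ⟨k, hk0, hki, rfl⟩
    by_cases hkb : (p ^ k) a = b
    · exact ⟨1, one_pos, hi0, by simp [hkb]⟩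
    · have hlt : k < i := lt_of_le_of_ne hki fun e => hkb (e ▸ hi)
      have hka : (p ^ k) a ≠ a := fun e => by
        refine hmin (i - k) (by omega) (by omega) ?_
        have : (p ^ i) a = (p ^ (i - k)) ((p ^ k) a) := by
          rw [← Perm.mul_apply, ← pow_add, Nat.sub_add_cancel hki]
        rw [← hi, this, e]
      refine ⟨k + 1, by omega, hlt, ?_⟩
      rw [Perm.mul_apply, swap_apply_of_ne_of_ne hka hkb, pow_succ', Perm.mul_apply]
  obtain ⟨k, hk0, hki, hk⟩ := hs.symm.mem_of_mapsTo hmaps ⟨i, hi0, le_rfl, hi⟩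
  rcases hki.lt_or_eq with hlt | rfl
  · refine hmin (i - k) (by omega) (by omega) ?_
    have : (p ^ i) a = (p ^ (i - k)) ((p ^ k) a) := by
      rw [← Perm.mul_apply, ← pow_add, Nat.sub_add_cancel hki]
    rw [← hi, this, hk]
  · exact hab (hk.symm.trans hi)

theorem sameCycle_of_sameCycle_mul_swap [Finite V] {p : Perm V} {a b : V} (hab : a ≠ b)
    (h : p.SameCycle a b) (x y : V) : p.SameCycle x y ↔ (p * swap a b).SameCycle x y ∨
      (((p * swap a b).SameCycle a x ∨ (p * swap a b).SameCycle b x) ∧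
        ((p * swap a b).SameCycle a y ∨ (p * swap a b).SameCycle b y)) := by
  rw [← sameCycle_mul_swap_iff (not_sameCycle_mul_swap hab h), mul_assoc, swap_mul_self, mul_one]

theorem cyclePairs_mul_swap_lt [Fintype V] {p : Perm V} {a b : V} (hab : a ≠ b)
    (h : p.SameCycle a b) : cyclePairs (p * swap a b) < cyclePairs p := by
  classical
  refine Finset.card_lt_card (Finset.ssubset_iff_of_subset ?_ |>.2 ⟨(a, b), ?_, ?_⟩)
  · rintro ⟨x, y⟩
    simp only [Finset.mem_filter, Finset.mem_univ, true_and]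
    exact fun hxy => (sameCycle_of_sameCycle_mul_swap hab h x y).2 (Or.inl hxy)
  · simpa
  · simpa using not_sameCycle_mul_swap hab h

/-- Choose `g` to minimise `cyclePairs` of `p * g.viaEmbedding f`. If two of the points still shared
a cycle, a further transposition would split it and lower the count. -/
theorem exists_eq_mul_viaEmbedding {ι : Type*} [Fintype V] [Finite ι] [DecidableEq ι]
    (f : ι ↪ V) (p : Perm V) :
    ∃ (q : Perm V) (h : Perm ι), p = q * h.viaEmbedding f ∧
      ∀ i j, q.SameCycle (f i) (f j) → i = j := by
  obtain ⟨g, hg⟩ := Finite.exists_min fun g : Perm ι => cyclePairs (p * g.viaEmbedding f)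
  refine ⟨p * g.viaEmbedding f, g⁻¹, ?_, fun i j hij => ?_⟩
  · simp only [← Perm.viaEmbeddingHom_apply, map_inv, mul_inv_cancel_right]
  · by_contra hne
    have h1 := hg (g * swap i j)
    rw [← Perm.viaEmbeddingHom_apply (g * _), map_mul, ← mul_assoc, Perm.viaEmbeddingHom_apply,
      Perm.viaEmbeddingHom_apply, Perm.viaEmbedding_swap] at h1
    exact absurd h1 (not_le.2 (cyclePairs_mul_swap_lt (f.injective.ne hne) hij))

end Swap

/-! ### Certificates valid for all weights -/

section Dominates

variable {V ι : Type*} [Fintype V] [Fintype ι] [DecidableEq ι]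

/-- As relations counted with multiplicity, the union of the same-cycle relations of `b` and `d`
is properly contained in that of `a` and `c`. -/
def Dominates (a c b d : Perm ι) : Prop :=
  (∀ i j, (if b.SameCycle i j then 1 else 0) + (if d.SameCycle i j then 1 else 0) ≤
    (if a.SameCycle i j then 1 else 0) + (if c.SameCycle i j then 1 else 0)) ∧
  ∃ i j, (if b.SameCycle i j then 1 else 0) + (if d.SameCycle i j then 1 else 0) <
    (if a.SameCycle i j then 1 else 0) + (if c.SameCycle i j then 1 else 0)

instance (a c b d : Perm ι) : Decidable (Dominates a c b d) := by
  unfold Dominates; infer_instance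

/-- The constant and the weights do not depend on `g`, so different `g` can be compared without
knowing them. -/
theorem exists_cyclePairs_eq_add_sum (f : ι ↪ V) {q : Perm V}
    (hq : ∀ i j, q.SameCycle (f i) (f j) → i = j) :
    ∃ (N : ℕ) (w : ι × ι → ℕ), (∀ p, 0 < w p) ∧ ∀ g : Perm ι,
      cyclePairs (q * g.viaEmbedding f) = N + ∑ p, if g.SameCycle p.1 p.2 then w p else 0 := by
  classical
  refine ⟨(Finset.univ.filter fun p : V × V =>
      (∀ i, ¬ q.SameCycle (f i) p.1) ∧ q.SameCycle p.1 p.2).card,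
    fun p => cycleLength q (f p.1) * cycleLength q (f p.2), fun p =>
    Nat.mul_pos (cycleLength_pos q (f p.1)) (cycleLength_pos q (f p.2)), fun g =>
    (cyclePairs_mul_viaEmbedding f hq g).trans ?_⟩
  congr!

theorem Dominates.cyclePairs_lt {a c b d : Perm ι} (h : Dominates a c b d) (f : ι ↪ V)
    {q : Perm V} (hq : ∀ i j, q.SameCycle (f i) (f j) → i = j) :
    cyclePairs (q * b.viaEmbedding f) + cyclePairs (q * d.viaEmbedding f) <
      cyclePairs (q * a.viaEmbedding f) + cyclePairs (q * c.viaEmbedding f) := by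
  obtain ⟨N, w, hpos, hw⟩ := exists_cyclePairs_eq_add_sum f hq
  simp only [hw]
  have hmul : ∀ (P Q : Prop) [Decidable P] [Decidable Q] (n : ℕ),
      ((if P then n else 0) + if Q then n else 0) =
        ((if P then 1 else 0) + if Q then 1 else 0) * n := by
    intro P Q _ _ n
    split_ifs <;> omega
  have key : (∑ p : ι × ι, if b.SameCycle p.1 p.2 then w p else 0) +
      (∑ p : ι × ι, if d.SameCycle p.1 p.2 then w p else 0) <
      (∑ p : ι × ι, if a.SameCycle p.1 p.2 then w p else 0) +
      (∑ p : ι × ι, if c.SameCycle p.1 p.2 then w p else 0) := by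
    rw [← Finset.sum_add_distrib, ← Finset.sum_add_distrib]
    refine lt_of_eq_of_lt (Finset.sum_congr rfl fun p _ => hmul _ _ _)
      (lt_of_lt_of_eq ?_ (Finset.sum_congr rfl fun p _ => (hmul _ _ _).symm))
    obtain ⟨i, j, hij⟩ := h.2
    exact Finset.sum_lt_sum (fun p _ => Nat.mul_le_mul_right _ (h.1 p.1 p.2))
      ⟨(i, j), Finset.mem_univ _, Nat.mul_lt_mul_of_pos_right hij (hpos _)⟩
  omega

end Dominates

section Refuted

variable {ι : Type*} [Fintype ι] [DecidableEq ι]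

/-- The product of the transpositions listed in `l`. -/
def swapProd (l : List (ι × ι)) : Perm ι :=
  (l.map fun p => swap p.1 p.2).prod

/-- Some words in `W` witness that the products `h * swapProd w` cannot all give the same number of
pairs on a common cycle. -/
def Refuted (W : List (List (ι × ι))) (h : Perm ι) : Prop :=
  ∃ a ∈ W, ∃ b ∈ W, ∃ c ∈ W, ∃ d ∈ W,
    Dominates (h * swapProd a) (h * swapProd c) (h * swapProd b) (h * swapProd d)

instance (W : List (List (ι × ι))) (h : Perm ι) : Decidable (Refuted W h) := by
  unfold Refuted; infer_instance

end Refuted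

/-! ### Local configurations that a CI sequence excludes -/

namespace PermSeq

section

variable {V : Type*}

theorem comp_eq_prod_reverse (u : List (Perm V)) : comp u = u.reverse.prod := by
  induction u with
  | nil => rfl
  | cons a l ih =>
    rw [List.reverse_cons, List.prod_append, List.prod_singleton, ← ih]
    rfl

theorem conjInvariant_iff {u : List (Perm V)} :
    ConjInvariant u ↔ ∀ l l' : List (Perm V), l.Perm u → l'.Perm u → IsConj l.prod l'.prod := by
  have key : ConjInvariant u ↔ ∀ l : List (Perm V), l.Perm u → IsConj (comp u) l.prod := by
    constructor
    · intro h l hl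
      refine h _ ⟨l.reverse, (List.reverse_perm l).trans hl, ?_⟩
      rw [comp_eq_prod_reverse, List.reverse_reverse]
    · rintro h _ ⟨l, hl, rfl⟩
      rw [comp_eq_prod_reverse l]
      exact h _ ((List.reverse_perm l).trans hl)
  rw [key]
  constructor
  · intro h l l' hl hl'
    exact (h l hl).symm.trans (h l' hl')
  · intro h l hl
    rw [comp_eq_prod_reverse]
    exact h _ _ (List.reverse_perm u) hl

theorem ConjInvariant.of_perm {u v : List (Perm V)} (hu : ConjInvariant u) (h : u.Perm v) :
    ConjInvariant v := by
  rw [conjInvariant_iff] at *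
  exact fun l l' hl hl' => hu l l' (hl.trans h.symm) (hl'.trans h.symm)

variable [DecidableEq V]

theorem prod_map_swap {ι : Type*} [DecidableEq ι] (f : ι ↪ V) (w : List (ι × ι)) :
    (w.map fun p => swap (f p.1) (f p.2)).prod = (swapProd w).viaEmbedding f := by
  rw [← Perm.viaEmbeddingHom_apply, swapProd, map_list_prod, List.map_map]
  congr 1
  refine List.map_congr_left fun p _ => ?_
  rw [Function.comp_apply, Perm.viaEmbeddingHom_apply, Perm.viaEmbedding_swap]

/-- All words in `W` complete `r` to a rearrangement of the same sequence, so their products share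
one value of `cyclePairs`; a certificate would make twice this value smaller than itself. -/
theorem ConjInvariant.not_refuted [Fintype V] {ι : Type*} [Fintype ι] [DecidableEq ι] {f : ι ↪ V}
    {w : List (ι × ι)} {r : List (Perm V)}
    (hu : ConjInvariant ((w.map fun p => swap (f p.1) (f p.2)) ++ r)) {q : Perm V} {h : Perm ι}
    (hr : r.prod = q * h.viaEmbedding f) (hq : ∀ i j, q.SameCycle (f i) (f j) → i = j)
    {W : List (List (ι × ι))} (hW : ∀ w' ∈ W, w'.Perm w) : ¬ Refuted W h := by
  have key : ∀ a ∈ W, ∀ b ∈ W, cyclePairs (q * (h * swapProd a).viaEmbedding f) =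
      cyclePairs (q * (h * swapProd b).viaEmbedding f) := by
    have hprod : ∀ a, q * (h * swapProd a).viaEmbedding f =
        (r ++ a.map fun p => swap (f p.1) (f p.2)).prod := fun a => by
      rw [← Perm.viaEmbeddingHom_apply, map_mul, ← mul_assoc, Perm.viaEmbeddingHom_apply,
        Perm.viaEmbeddingHom_apply, ← hr, List.prod_append, prod_map_swap]
    intro a ha b hb
    rw [hprod, hprod]
    have hp : ∀ a ∈ W, (r ++ a.map fun p => swap (f p.1) (f p.2)).Perm
        ((w.map fun p => swap (f p.1) (f p.2)) ++ r) := fun a ha =>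
      List.perm_append_comm.trans (((hW a ha).map _).append_right r)
    exact cyclePairs_eq_of_isConj (conjInvariant_iff.1 hu _ _ (hp a ha) (hp b hb))
  rintro ⟨a, ha, b, hb, c, hc, d, hd, hdom⟩
  have h1 := hdom.cyclePairs_lt f hq
  rw [key a ha b hb, key c hc d hd] at h1
  exact lt_irrefl _ h1

/-- The embedding of `Fin 4` with four given distinct values. -/
def quadEmbedding {a b c d : V} (h : [a, b, c, d].Nodup) : Fin 4 ↪ V where
  toFun := ![a, b, c, d]
  inj' := by
    simp only [List.nodup_cons, List.mem_cons, List.not_mem_nil, not_or, or_false] at h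
    intro i j hij
    fin_cases i <;> fin_cases j <;> simp_all [eq_comm]

/-- All six orders of the three edges are listed. For `h = 1` each of them gives a 4-cycle, hence
the exclusion of that case. -/
theorem star_refuted : ∀ h : Perm (Fin 4), h ≠ 1 →
    Refuted [[((0 : Fin 4), (1 : Fin 4)), (0, 2), (0, 3)], [(0, 1), (0, 3), (0, 2)],
      [(0, 2), (0, 1), (0, 3)], [(0, 2), (0, 3), (0, 1)], [(0, 3), (0, 1), (0, 2)],
      [(0, 3), (0, 2), (0, 1)]] h := by
  decide +kernel

/-- Only `h = 1` survives `star_refuted`, and then the product of the remaining terms is `q` itself,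
which separates the four vertices. -/
theorem ConjInvariant.not_sameCycle_of_star [Fintype V] {b x y z : V} (hn : [b, x, y, z].Nodup)
    {r : List (Perm V)} (hu : ConjInvariant (swap b x :: swap b y :: swap b z :: r)) :
    ¬ r.prod.SameCycle b x ∧ ¬ r.prod.SameCycle x y := by
  obtain ⟨q, h, hr, hq⟩ := exists_eq_mul_viaEmbedding (quadEmbedding hn) r.prod
  have h1 : h = 1 := by
    by_contra hne
    refine ConjInvariant.not_refuted (w := [(0, 1), (0, 2), (0, 3)]) hu hr hq ?_ (star_refuted h hne)
    decide
  subst h1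
  rw [← Perm.viaEmbeddingHom_apply, map_one, mul_one] at hr
  rw [hr]
  refine ⟨fun hs => ?_, fun hs => ?_⟩
  · exact absurd (hq 0 1 hs) (by decide)
  · exact absurd (hq 1 2 hs) (by decide)

end

end PermSeq

namespace PermSeq

variable {V : Type*} [DecidableEq V]

/-- Six orders suffice for every `h`, so the configuration is excluded with no condition on the
remaining terms. -/
theorem adjacent_doubled_refuted_of_end : ∀ h : Perm (Fin 4),
    Refuted [[((1 : Fin 4), (2 : Fin 4)), (0, 1), (0, 3), (0, 1), (1, 2)],
      [(0, 1), (0, 3), (0, 1), (1, 2), (1, 2)], [(0, 3), (1, 2), (0, 1), (1, 2), (0, 1)],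
      [(1, 2), (0, 1), (0, 3), (1, 2), (0, 1)], [(0, 1), (0, 3), (1, 2), (0, 1), (1, 2)],
      [(0, 3), (0, 1), (1, 2), (0, 1), (1, 2)]] h := by
  decide +kernel

theorem adjacent_doubled_refuted_of_middle : ∀ h : Perm (Fin 4),
    Refuted [[((0 : Fin 4), (1 : Fin 4)), (0, 1), (1, 2), (1, 3), (1, 2)],
      [(0, 1), (0, 1), (1, 2), (1, 2), (1, 3)], [(1, 2), (0, 1), (1, 3), (1, 2), (0, 1)],
      [(1, 2), (0, 1), (1, 2), (0, 1), (1, 3)], [(0, 1), (1, 2), (0, 1), (1, 3), (1, 2)],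
      [(0, 1), (1, 2), (0, 1), (1, 2), (1, 3)]] h := by
  decide +kernel

theorem not_conjInvariant_of_adjacent_doubled_end [Fintype V] {x y z w : V}
    (hn : [x, y, z, w].Nodup) (r : List (Perm V)) :
    ¬ ConjInvariant (swap x y :: swap x y :: swap y z :: swap y z :: swap x w :: r) := by
  intro hu
  obtain ⟨q, h, hr, hq⟩ := exists_eq_mul_viaEmbedding (quadEmbedding hn) r.prod
  refine ConjInvariant.not_refuted (w := [(0, 1), (0, 1), (1, 2), (1, 2), (0, 3)]) hu hr hq ?_
    (adjacent_doubled_refuted_of_end h)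
  decide

theorem not_conjInvariant_of_adjacent_doubled_middle [Fintype V] {x y z w : V}
    (hn : [x, y, z, w].Nodup) (r : List (Perm V)) :
    ¬ ConjInvariant (swap x y :: swap x y :: swap y z :: swap y z :: swap y w :: r) := by
  intro hu
  obtain ⟨q, h, hr, hq⟩ := exists_eq_mul_viaEmbedding (quadEmbedding hn) r.prod
  refine ConjInvariant.not_refuted (w := [(0, 1), (0, 1), (1, 2), (1, 2), (1, 3)]) hu hr hq ?_
    (adjacent_doubled_refuted_of_middle h)
  decide

/-- The path `w a b c`, when the other terms fix `a`, `b` and bring `w`, `c` onto one cycle. -/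
theorem not_conjInvariant_of_path [Fintype V] {w a b c : V} (hn : [w, a, b, c].Nodup)
    {r : List (Perm V)} (ha : r.prod a = a) (hb : r.prod b = b) (hwc : r.prod.SameCycle w c) :
    ¬ ConjInvariant (swap w a :: swap a b :: swap b c :: r) := by
  intro hu
  have hne := hn
  simp only [List.nodup_cons, List.mem_cons, List.not_mem_nil, not_or, or_false] at hne
  -- Splitting the common cycle of `w` and `c` puts the four vertices on distinct cycles of `q`, and
  -- the split is undone by `h = swap 0 3`.
  set q := r.prod * swap w c with hqdef
  have hqa : q a = a := by
    rw [hqdef, Perm.mul_apply, swap_apply_of_ne_of_ne (by tauto) (by tauto), ha]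
  have hqb : q b = b := by
    rw [hqdef, Perm.mul_apply, swap_apply_of_ne_of_ne (by tauto) (by tauto), hb]
  have hwc' : ¬ q.SameCycle w c := not_sameCycle_mul_swap (by tauto) hwc
  refine ConjInvariant.not_refuted (w := [(0, 1), (1, 2), (2, 3)])
    (W := [(0, 1), (1, 2), (2, 3)].permutations') (q := q) (h := swap 0 3)
    (f := quadEmbedding hn) hu ?_ ?_ (fun w' hw' => List.mem_permutations'.1 hw') (by decide +kernel)
  · rw [Perm.viaEmbedding_swap]
    exact (mul_swap_mul_self w c r.prod).symm
  · have hfa : ∀ z, q.SameCycle a z → a = z := fun z hz => hz.eq_of_left hqa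
    have hfb : ∀ z, q.SameCycle b z → b = z := fun z hz => hz.eq_of_left hqb
    intro i j hij
    fin_cases i <;> fin_cases j
    all_goals first
      | rfl
      | exact absurd hij hwc'
      | exact absurd hij.symm hwc'
      | exact (quadEmbedding hn).injective (hfa _ hij)
      | exact (quadEmbedding hn).injective (hfb _ hij)
      | exact (quadEmbedding hn).injective (hfa _ hij.symm).symm
      | exact (quadEmbedding hn).injective (hfb _ hij.symm).symm

/-- A doubled edge `x y` with a further edge at either end, all in distinct cycles of the rest. -/
theorem not_conjInvariant_of_doubled_middle [Fintype V] {x y c d : V} (hn : [x, y, c, d].Nodup)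
    {r : List (Perm V)} (hr : [x, y, c, d].Pairwise fun a b => ¬ r.prod.SameCycle a b) :
    ¬ ConjInvariant (swap x y :: swap x y :: swap y c :: swap x d :: r) := by
  intro hu
  simp only [List.pairwise_cons, List.mem_cons, List.not_mem_nil, or_false, forall_eq_or_imp,
    forall_eq] at hr
  refine ConjInvariant.not_refuted (w := [(0, 1), (0, 1), (1, 2), (0, 3)])
    (W := [(0, 1), (0, 1), (1, 2), (0, 3)].permutations') (q := r.prod) (h := 1)
    (f := quadEmbedding hn) hu ?_ ?_ (fun w' hw' => List.mem_permutations'.1 hw') (by decide +kernel)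
  · rw [← Perm.viaEmbeddingHom_apply, map_one, mul_one]
  · intro i j hij
    by_contra hne
    have hij' := hij.symm
    obtain ⟨⟨h1, h2, h3⟩, ⟨h4, h5⟩, h6, -⟩ := hr
    fin_cases i <;> fin_cases j <;> first
      | exact hne rfl | exact h1 hij | exact h2 hij | exact h3 hij | exact h4 hij | exact h5 hij
      | exact h6 hij | exact h1 hij' | exact h2 hij' | exact h3 hij' | exact h4 hij'
      | exact h5 hij' | exact h6 hij'

/-- The embedding of `Fin 3` with three given distinct values. -/
def tripleEmbedding {a b c : V} (h : [a, b, c].Nodup) : Fin 3 ↪ V where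
  toFun := ![a, b, c]
  inj' := by
    simp only [List.nodup_cons, List.mem_cons, List.not_mem_nil, not_or, or_false] at h
    intro i j hij
    fin_cases i <;> fin_cases j <;> simp_all [eq_comm]

/-- The circuit is closed by the remaining terms, which join `x` and `c`. Splitting that cycle
leaves three points on distinct cycles and the single case `h = swap 0 2`. -/
theorem not_conjInvariant_of_doubled_circuit [Fintype V] {x y c : V} (hn : [x, y, c].Nodup)
    {r : List (Perm V)} (hy : r.prod y = y) (hxc : r.prod.SameCycle x c) :
    ¬ ConjInvariant (swap x y :: swap x y :: swap y c :: r) := by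
  intro hu
  have hne := hn
  simp only [List.nodup_cons, List.mem_cons, List.not_mem_nil, not_or, or_false] at hne
  set q := r.prod * swap x c with hqdef
  have hqy : q y = y := by
    rw [hqdef, Perm.mul_apply, swap_apply_of_ne_of_ne (by tauto) (by tauto), hy]
  have hxc' : ¬ q.SameCycle x c := not_sameCycle_mul_swap (by tauto) hxc
  refine ConjInvariant.not_refuted (w := [(0, 1), (0, 1), (1, 2)])
    (W := [(0, 1), (0, 1), (1, 2)].permutations') (q := q) (h := swap 0 2)
    (f := tripleEmbedding hn) hu ?_ ?_ (fun w' hw' => List.mem_permutations'.1 hw')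
    (by decide +kernel)
  · rw [Perm.viaEmbedding_swap]
    exact (mul_swap_mul_self x c r.prod).symm
  · have hfy : ∀ z, q.SameCycle y z → y = z := fun z hz => hz.eq_of_left hqy
    intro i j hij
    fin_cases i <;> fin_cases j
    all_goals first
      | rfl
      | exact absurd hij hxc'
      | exact absurd hij.symm hxc'
      | exact (tripleEmbedding hn).injective (hfy _ hij)
      | exact (tripleEmbedding hn).injective (hfy _ hij.symm).symm

end PermSeq

/-! ### Ordering terms so that two points share a cycle -/

namespace PermSeq

variable {V : Type*}

theorem prod_apply_eq_self {l : List (Perm V)} {x : V} (h : ∀ t ∈ l, t x = x) : l.prod x = x := by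
  induction l with
  | nil => rfl
  | cons a l ih =>
    rw [List.prod_cons, Perm.mul_apply, ih fun t ht => h t (List.mem_cons_of_mem _ ht),
      h a List.mem_cons_self]

variable [DecidableEq V]

/-- If `a` is on another cycle, the transposition only merges. Otherwise it splits the cycle, and
the two products are conjugate by `swap x a`: if `y` falls on the part of `a` in one of them, it
falls on the part of `x` in the other. -/
theorem sameCycle_mul_swap_or_swap_mul [Finite V] {p : Perm V} {x y a : V} (h : p.SameCycle x y)
    (hax : a ≠ x) (hay : a ≠ y) :
    (p * swap x a).SameCycle x y ∨ (swap x a * p).SameCycle x y := by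
  by_cases hxa : p.SameCycle x a
  · have hconj : swap x a * p = swap x a * (p * swap x a) * (swap x a)⁻¹ := by
      rw [swap_inv, ← mul_assoc, mul_swap_mul_self]
    by_cases hxy : (p * swap x a).SameCycle x y
    · exact Or.inl hxy
    · right
      have h1 := (sameCycle_of_sameCycle_mul_swap hax.symm hxa x y).1 h
      have hyx : y ≠ x := fun e => hxy (e ▸ Perm.SameCycle.refl _ _)
      rw [hconj, Perm.sameCycle_conj, swap_inv, swap_apply_left,
        swap_apply_of_ne_of_ne hyx hay.symm]
      tauto
  · exact Or.inl ((sameCycle_mul_swap_iff hxa x y).2 (Or.inl h))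

/-- Each further term is attached at whichever end keeps `x` and `y` together. -/
theorem exists_perm_append_sameCycle [Finite V] {x y : V} {l : List (Perm V)}
    (hl : l.prod.SameCycle x y) :
    ∀ σ : List (Perm V), (∀ t ∈ σ, ∃ a, a ≠ x ∧ a ≠ y ∧ t = swap x a) →
      ∃ l' : List (Perm V), l'.Perm (σ ++ l) ∧ l'.prod.SameCycle x y := by
  intro σ
  induction σ with
  | nil => exact fun _ => ⟨l, List.Perm.refl _, hl⟩
  | cons s σ ih =>
    intro hσ
    obtain ⟨l', hl', hs⟩ := ih fun t ht => hσ t (List.mem_cons_of_mem _ ht)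
    obtain ⟨a, hax, hay, rfl⟩ := hσ s List.mem_cons_self
    rcases sameCycle_mul_swap_or_swap_mul hs hax hay with h | h
    · refine ⟨l' ++ [swap x a], ?_, by simpa using h⟩
      exact (List.perm_append_comm).trans ((hl'.cons _))
    · exact ⟨swap x a :: l', hl'.cons _, by simpa using h⟩

theorem IsSwap.eq_swap_apply {t : Perm V} (ht : t.IsSwap) {x : V} (hx : t x ≠ x) :
    t = swap x (t x) := by
  obtain ⟨a, b, -, rfl⟩ := ht
  by_cases ha : x = a
  · subst ha; rw [swap_apply_left]
  · by_cases hb : x = b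
    · subst hb; rw [swap_apply_right, swap_comm]
    · exact absurd (swap_apply_of_ne_of_ne ha hb) hx

/-- The end points of a path of terms of `u` can be brought onto one cycle of the product of a
rearrangement of `u`, provided that one of them lies on no repeated term. -/
theorem exists_perm_sameCycle_of_path [Fintype V] {G : SimpleGraph V} {x y : V} (p : G.Walk x y)
    (hp : p.IsPath) (hxy : x ≠ y) (u : List (Perm V)) (hu : ∀ t ∈ u, t.IsSwap)
    (hy : ∀ z, z ≠ y → u.count (swap z y) ≤ 1) (hpu : ∀ d ∈ p.darts, swap d.fst d.snd ∈ u) :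
    ∃ l : List (Perm V), l.Perm u ∧ l.prod.SameCycle x y := by
  induction p generalizing u with
  | nil => exact absurd rfl hxy
  | @cons x v y hadj p ih =>
    rw [SimpleGraph.Walk.cons_isPath_iff] at hp
    -- The terms fixing `x` are arranged first, so that `x` is a fixed point of their product. One
    -- term at `x` then joins it to the cycle of `y`, and the other terms at `x` are attached at the
    -- ends.
    set u' := u.filter fun t => t x = x with hu'
    set σ := u.filter fun t => !decide (t x = x) with hσ
    have hsplit : (σ ++ u').Perm u :=
      List.perm_append_comm.trans (List.filter_append_perm _ u)
    have hσx : ∀ t ∈ σ, t ∈ u ∧ t = swap x (t x) ∧ t x ≠ x := fun t ht => by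
      simp only [hσ, List.mem_filter, Bool.not_eq_true', decide_eq_false_iff_not] at ht
      exact ⟨ht.1, IsSwap.eq_swap_apply (hu t ht.1) ht.2, ht.2⟩
    have hfix : ∀ l : List (Perm V), l.Perm u' → ∀ z, l.prod.SameCycle x z → x = z :=
      fun l hl z hz => hz.eq_of_left (prod_apply_eq_self fun t ht => by
        have := hl.subset ht
        simpa [hu'] using (List.mem_filter.1 this).2)
    have main : ∀ a, a ≠ x → swap x a ∈ u → ∀ l₀ : List (Perm V), l₀.Perm u' →
        (l₀.prod * swap x a).SameCycle x y → swap x y ∉ σ.erase (swap x a) →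
        ∃ l : List (Perm V), l.Perm u ∧ l.prod.SameCycle x y := by
      intro a hax hau l₀ hl₀ hs hnot
      have haσ : swap x a ∈ σ := by simp [hσ, hau, hax]
      obtain ⟨l, hl, hls⟩ := exists_perm_append_sameCycle (x := x) (y := y)
        (l := l₀ ++ [swap x a]) (by simpa using hs) (σ.erase (swap x a)) (fun t ht => by
          obtain ⟨-, h2, h3⟩ := hσx t (List.mem_of_mem_erase ht)
          refine ⟨t x, h3, fun e => hnot ?_, h2⟩
          rw [e] at h2
          rwa [← h2])
      refine ⟨l, hl.trans (List.Perm.trans ?_ hsplit), hls⟩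
      calc (σ.erase (swap x a) ++ (l₀ ++ [swap x a])).Perm
            (σ.erase (swap x a) ++ (swap x a :: u')) :=
              (List.perm_append_comm.trans (hl₀.cons _)).append_left _
        _ |>.Perm (swap x a :: (σ.erase (swap x a) ++ u')) := List.perm_middle
        _ |>.Perm (σ ++ u') := ((List.perm_cons_erase haσ).symm).append_right u'
    -- Attaching at the ends is not available for the term `swap x y`. If that term occurs it must
    -- be the joining one, and the multiplicity bound at `y` leaves no second copy.
    by_cases hxyu : swap x y ∈ u
    · refine main y hxy.symm hxyu u' (List.Perm.refl _) ?_ ?_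
      · rw [sameCycle_mul_swap_iff fun h => hxy (hfix _ (List.Perm.refl _) _ h)]
        right
        exact ⟨Or.inl (Perm.SameCycle.refl _ _), Or.inr (Perm.SameCycle.refl _ _)⟩
      · intro hmem
        have h1 := List.count_pos_iff.2 hmem
        rw [List.count_erase_self, hσ] at h1
        have h2 := hy x hxy
        have h3 := (List.filter_sublist (p := fun t => !decide (t x = x)) (l := u)).count_le (swap x y)
        omega
    · have hvu := hpu ⟨(x, v), hadj⟩ (by simp)
      simp only at hvu
      have hvx : v ≠ x := hadj.ne'
      have hvy : v ≠ y := fun e => hxyu (e ▸ hvu)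
      obtain ⟨l₀, hl₀, hs⟩ := ih hp.1 hvy u' (fun t ht => hu t (List.mem_of_mem_filter ht))
        (fun z hz => (List.filter_sublist.count_le _).trans (hy z hz)) (fun d hd => by
          have h1 := hpu d (by simp [hd])
          refine List.mem_filter.2 ⟨h1, ?_⟩
          have h2 : d.fst ∈ p.support := p.dart_fst_mem_support_of_mem_darts hd
          have h3 : d.snd ∈ p.support := p.dart_snd_mem_support_of_mem_darts hd
          simp only [decide_eq_true_eq]
          exact swap_apply_of_ne_of_ne (fun e => hp.2 (e ▸ h2)) (fun e => hp.2 (e ▸ h3)))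
      refine main v hvx hvu l₀ hl₀ ?_ ?_
      · rw [sameCycle_mul_swap_iff fun h => hvx (hfix _ hl₀ _ h).symm]
        right
        exact ⟨Or.inl (Perm.SameCycle.refl _ _), Or.inr hs⟩
      · exact fun hmem => hxyu (hσx _ (List.mem_of_mem_erase hmem)).1

end PermSeq

/-! ### Reading the multigraph off the sequence -/

section Multigraph

variable {V : Type*} [Fintype V] [DecidableEq V] {u : List (Perm V)} {x y : V}

theorem transpositionalMultigraph_mult (h : x ≠ y) :
    (transpositionalMultigraph u).mult x y = u.count (swap x y) := if_neg h

theorem transpositionalMultigraph_isMultiedge :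
    (transpositionalMultigraph u).IsMultiedge x y ↔ x ≠ y ∧ swap x y ∈ u := by
  unfold LooplessMultigraph.IsMultiedge
  by_cases h : x = y
  · subst h; simp [(transpositionalMultigraph u).loopless]
  · rw [transpositionalMultigraph_mult h, List.count_pos_iff]
    tauto

theorem transpositionalMultigraph_adj :
    (transpositionalMultigraph u).toSimpleGraph.Adj x y ↔ x ≠ y ∧ swap x y ∈ u :=
  transpositionalMultigraph_isMultiedge

end Multigraph

/-! ### Cancelling pairs of equal terms -/

namespace PermSeq

variable {V : Type*} [DecidableEq V]

theorem isSwap_mul_self {t : Perm V} (ht : t.IsSwap) : t * t = 1 := by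
  obtain ⟨a, b, -, rfl⟩ := ht
  exact swap_mul_self a b

/-- Rearrangements that begin with `t, t` have the same products as those of `u`. -/
theorem ConjInvariant.of_cons_cons {t : Perm V} (ht : t.IsSwap) {u : List (Perm V)}
    (hu : ConjInvariant (t :: t :: u)) : ConjInvariant u := by
  rw [conjInvariant_iff] at *
  intro l l' hl hl'
  have h := hu _ _ ((hl.cons t).cons t) ((hl'.cons t).cons t)
  simpa only [List.prod_cons, ← mul_assoc, isSwap_mul_self ht, one_mul] using h

theorem exists_perm_append_of_count_le [Fintype V] {l u : List (Perm V)}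
    (h : ∀ t ∈ l, l.count t ≤ u.count t) :
    ∃ r, u.Perm (l ++ r) ∧ ∀ t, u.count t = l.count t + r.count t := by
  obtain ⟨l', hl', hsub⟩ := List.subperm_ext_iff.2 h
  obtain ⟨r, hr⟩ := hsub.exists_perm_append
  replace hr := hr.trans (hl'.append_right r)
  exact ⟨r, hr, fun t => by rw [hr.count_eq, List.count_append]⟩

/-- Multiplicities can be lowered by two at a time, so CI passes to every sequence with smaller
multiplicities of the same parities. -/
theorem ConjInvariant.of_count_le [Fintype V] {u v : List (Perm V)} (hu : ConjInvariant u)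
    (hs : Transpositional u) (hle : ∀ t, v.count t ≤ u.count t)
    (hpar : ∀ t, v.count t % 2 = u.count t % 2) : ConjInvariant v := by
  induction hn : u.length using Nat.strong_induction_on generalizing u with
  | _ n ih =>
    by_cases hlt : ∃ t, v.count t < u.count t
    · obtain ⟨t, ht⟩ := hlt
      have h2 := hpar t
      obtain ⟨w, hw, hcount⟩ := exists_perm_append_of_count_le (l := [t, t]) (u := u) (by
        intro s hs
        simp only [List.mem_cons, List.not_mem_nil, or_false, or_self] at hs
        subst hs
        simp only [List.count_cons_self, List.count_nil]
        omega)
      rw [List.cons_append, List.cons_append, List.nil_append] at hw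
      have htu : t ∈ u := hw.symm.subset (by simp)
      refine ih w.length ?_ ((hu.of_perm hw).of_cons_cons (hs t htu))
        (fun s hsw => hs s (hw.symm.subset (by simp [hsw]))) (fun s => ?_) (fun s => ?_) rfl
      · rw [← hn, hw.length_eq]; simp
      · have h1 := hle s
        have h3 := hpar s
        rw [hcount s] at h1 h3
        by_cases hst : t = s
        · subst hst
          rw [hcount t] at ht h2
          simp only [List.count_cons_self, List.count_nil] at *
          omega
        · simpa [List.count_cons, hst] using h1
      · have h3 := hpar s
        rw [hcount s] at h3
        by_cases hst : t = s
        · subst hst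
          simp only [List.count_cons_self, List.count_nil] at *
          omega
        · simpa [List.count_cons, hst] using h3
    · push Not at hlt
      exact hu.of_perm (List.perm_iff_count.2 fun t => le_antisymm (hlt t) (hle t))

theorem reachable_prod_apply [Fintype V] {r s : List (Perm V)} (hr : Transpositional r) (hs : ∀ t ∈ s, t ∈ r)
    (x : V) : (transpositionalMultigraph r).toSimpleGraph.Reachable x (s.prod x) := by
  induction s with
  | nil => exact .refl x
  | cons t s ih =>
    refine (ih fun t ht => hs t (List.mem_cons_of_mem _ ht)).trans ?_
    rw [List.prod_cons, Perm.mul_apply]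
    by_cases hx : t (s.prod x) = s.prod x
    · rw [hx]
    · have htr := hs t List.mem_cons_self
      refine SimpleGraph.Adj.reachable (transpositionalMultigraph_adj.2 ⟨Ne.symm hx, ?_⟩)
      rwa [← IsSwap.eq_swap_apply (hr t htr) hx]

theorem reachable_of_sameCycle_prod [Fintype V] {r : List (Perm V)} (hr : Transpositional r)
    {x y : V} (h : r.prod.SameCycle x y) :
    (transpositionalMultigraph r).toSimpleGraph.Reachable x y :=
  h.of_forall (r := (transpositionalMultigraph r).toSimpleGraph.Reachable)
    ⟨fun _ => .refl _, fun h => h.symm, fun h h' => h.trans h'⟩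
    (reachable_prod_apply hr fun _ h => h)

/-- The terms of `u`, those of odd multiplicity once and those of even multiplicity twice. -/
def parityReduced [Fintype V] (u : List (Perm V)) : List (Perm V) :=
  u.dedup ++ u.dedup.filter fun t => Even (u.count t)

/-- The terms of odd multiplicity of `u`, each of them once. -/
def oddTerms [Fintype V] (u : List (Perm V)) : List (Perm V) :=
  u.dedup.filter fun t => Odd (u.count t)

theorem count_parityReduced [Fintype V] (u : List (Perm V)) (t : Perm V) :
    (parityReduced u).count t = if t ∈ u then (if Even (u.count t) then 2 else 1) else 0 := by
  rw [parityReduced, List.count_append, List.count_dedup]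
  by_cases he : Even (u.count t)
  · rw [List.count_filter (by simpa using he), List.count_dedup]
    split_ifs <;> rfl
  · rw [List.count_eq_zero_of_not_mem (by simp [he])]
    simp [he]

theorem count_oddTerms [Fintype V] (u : List (Perm V)) (t : Perm V) :
    (oddTerms u).count t = if Odd (u.count t) then 1 else 0 := by
  rw [oddTerms]
  by_cases he : Odd (u.count t)
  · rw [List.count_filter (by simpa using he), List.count_dedup, if_pos he, if_pos]
    exact List.count_pos_iff.1 he.pos
  · rw [List.count_eq_zero_of_not_mem (by simp [he]), if_neg he]

theorem conjInvariant_parityReduced [Fintype V] {u : List (Perm V)} (hu : ConjInvariant u)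
    (hs : Transpositional u) : ConjInvariant (parityReduced u) := by
  refine hu.of_count_le hs (fun t => ?_) fun t => ?_ <;> rw [count_parityReduced]
  · split_ifs with h1 h2
    · have := List.count_pos_iff.2 h1
      obtain ⟨k, hk⟩ := h2
      omega
    · exact List.count_pos_iff.2 h1
    · exact Nat.zero_le _
  · split_ifs with h1 h2
    · rw [Nat.even_iff.1 h2]
    · rw [Nat.not_even_iff.1 h2]
    · rw [List.count_eq_zero_of_not_mem h1]

end PermSeq

/-- Rotate the circuit to start at `b` and cut off its first and last edges. -/
theorem SimpleGraph.Walk.IsCycle.exists_isPath_of_mem_support {V : Type*} {G : SimpleGraph V}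
    {v b : V} {c : G.Walk v v} (hc : c.IsCycle) (hb : b ∈ c.support) :
    ∃ (x y : V) (p : G.Walk x y), p.IsPath ∧ b ∉ p.support ∧ x ≠ y ∧ G.Adj b x ∧ G.Adj b y ∧
      (∀ z, s(b, z) ∈ c.edges ↔ z = x ∨ z = y) ∧ (∀ d ∈ p.darts, d.edge ∈ c.edges) ∧
      ∀ z ∈ p.support, z ∈ c.support := by
  classical
  have hc' := hc.rotate hb
  have hedges : ∀ e, e ∈ (c.rotate b hb).edges ↔ e ∈ c.edges := fun e =>
    (c.rotate_edges b hb).mem_iff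
  have hsupp : ∀ z, z ∈ (c.rotate b hb).support → z ∈ c.support := fun z =>
    (c.mem_support_rotate_iff b hb).1
  generalize c.rotate b hb = c' at hc' hedges hsupp
  match c', hc' with
  | .nil, h => exact absurd h (by simp)
  | .cons (v := x) h p, hc' =>
    rw [SimpleGraph.Walk.cons_isCycle_iff] at hc'
    obtain ⟨hp, hne⟩ := hc'
    have hpr := hp.reverse
    have hre : ∀ e, e ∈ p.reverse.edges ↔ e ∈ p.edges := fun e => by simp
    have hrs : ∀ e, e ∈ p.reverse.support ↔ e ∈ p.support := fun e => by simp
    generalize p.reverse = p' at hpr hre hrs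
    match p', hpr with
    | .nil, _ => exact absurd h (by simp)
    | .cons (v := y) h' p', hpr =>
      rw [SimpleGraph.Walk.cons_isPath_iff] at hpr
      refine ⟨y, x, p', hpr.1, hpr.2, ?_, h', h, ?_, ?_, ?_⟩
      · rintro rfl
        exact hne ((hre _).1 (by simp))
      · intro z
        rw [← hedges, SimpleGraph.Walk.edges_cons, List.mem_cons, ← hre,
          SimpleGraph.Walk.edges_cons, List.mem_cons]
        constructor
        · rintro (hz | hz | hz)
          · right; simpa [h.ne] using hz
          · left; simpa [h'.ne] using hz
          · exact absurd (p'.fst_mem_support_of_mem_edges hz) hpr.2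
        · rintro (rfl | rfl) <;> simp
      · intro d hd
        rw [← hedges, SimpleGraph.Walk.edges_cons, List.mem_cons, ← hre,
          SimpleGraph.Walk.edges_cons, List.mem_cons]
        exact Or.inr (Or.inr (List.mem_map_of_mem hd))
      · intro z hz
        refine hsupp z ?_
        rw [SimpleGraph.Walk.support_cons, List.mem_cons, ← hrs, SimpleGraph.Walk.support_cons,
          List.mem_cons]
        exact Or.inr (Or.inr hz)

theorem SimpleGraph.Connected.mem_of_forall_adj {V : Type*} {G : SimpleGraph V} (hG : G.Connected)
    {S : Set V} {x : V} (hx : x ∈ S) (hS : ∀ y ∈ S, ∀ z, G.Adj y z → z ∈ S) (z : V) : z ∈ S := by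
  obtain ⟨p⟩ := hG.preconnected x z
  induction p with
  | nil => exact hx
  | cons h _ ih => exact ih (hS _ hx _ h)

/-! ### Necessity: non-simple multiedges do not touch -/

namespace PermSeq

variable {V : Type*} [DecidableEq V] {u : List (Perm V)}

theorem swap_eq_swap_iff {a b c d : V} (h : a ≠ b) :
    swap a b = swap c d ↔ (a = c ∧ b = d) ∨ (a = d ∧ b = c) := by
  constructor
  · intro he
    have h1 : swap c d a = b := by rw [← he, swap_apply_left]
    by_cases hac : a = c
    · subst hac; rw [swap_apply_left] at h1; exact Or.inl ⟨rfl, h1.symm⟩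
    · by_cases had : a = d
      · subst had; rw [swap_apply_right] at h1; exact Or.inr ⟨rfl, h1.symm⟩
      · rw [swap_apply_of_ne_of_ne hac had] at h1; exact absurd h1 h
  · rintro (⟨rfl, rfl⟩ | ⟨rfl, rfl⟩)
    · rfl
    · exact swap_comm _ _

variable [Fintype V]

omit [DecidableEq V] in
theorem exists_ne_of_four_le_card (hV : 4 ≤ Fintype.card V) (x y z : V) :
    ∃ w, w ≠ x ∧ w ≠ y ∧ w ≠ z := by
  classical
  by_contra! h
  have : (Finset.univ : Finset V) ⊆ {x, y, z} := fun w _ => by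
    simp only [Finset.mem_insert, Finset.mem_singleton]
    by_contra! hw
    exact hw.2.2 (h w hw.1 hw.2.1)
  have h1 := Finset.card_le_card this
  have h2 := Finset.card_le_three (a := x) (b := y) (c := z)
  rw [Finset.card_univ] at h1
  omega

/-- Two non-simple multiedges at `y` span three vertices. By connectedness some edge leaves them
towards a fourth, and both positions of this edge, at an end or at the middle, are excluded
configurations. -/
theorem ConjInvariant.nonsimpleDisjoint (hu : ConjInvariant u)
    (hc : (transpositionalMultigraph u).Connected) (hV : 4 ≤ Fintype.card V) :
    (transpositionalMultigraph u).NonsimpleDisjoint := by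
  intro y x z hyx hyz
  by_contra hxz
  have hne : ∀ {a b}, (transpositionalMultigraph u).IsNonsimpleMultiedge a b → a ≠ b := by
    rintro a b h rfl
    unfold LooplessMultigraph.IsNonsimpleMultiedge at h
    rw [(transpositionalMultigraph u).loopless] at h
    omega
  have hx := hne hyx
  have hz := hne hyz
  unfold LooplessMultigraph.IsNonsimpleMultiedge at hyx hyz
  rw [transpositionalMultigraph_mult hx] at hyx
  rw [transpositionalMultigraph_mult hz] at hyz
  obtain ⟨v, w, hv, hw, hvw⟩ : ∃ v w, (v = x ∨ v = y ∨ v = z) ∧ (w ≠ x ∧ w ≠ y ∧ w ≠ z) ∧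
      swap v w ∈ u := by
    by_contra! h
    obtain ⟨w, hw⟩ := exists_ne_of_four_le_card hV x y z
    have := hc.mem_of_forall_adj (S := {v | v = x ∨ v = y ∨ v = z}) (x := x) (by simp)
      (fun v hv w hvw => by
        by_contra hw
        simp only [Set.mem_ofPred_eq, not_or] at hw
        exact h v w hv hw (transpositionalMultigraph_adj.1 hvw).2) w
    simp only [Set.mem_ofPred_eq] at this
    tauto
  have hvw1 := List.count_pos_iff.2 hvw
  -- The exit at `z` is the exit at `x` with the two ends exchanged, so two positions of `v` are
  -- enough.
  have key : ∀ x z v, x ≠ y → y ≠ z → x ≠ z → (v = x ∨ v = y) → w ≠ x → w ≠ y → w ≠ z →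
      2 ≤ u.count (swap y x) → 2 ≤ u.count (swap y z) → 0 < u.count (swap v w) → False := by
    intro x z v hxy hyz hxz hv hwx hwy hwz hyx2 hyz2 hvw
    obtain ⟨r, hr, -⟩ := exists_perm_append_of_count_le
        (l := [swap x y, swap x y, swap y z, swap y z, swap v w]) (u := u) (by
      have h1 : swap x y ≠ swap y z := by rw [Ne, swap_eq_swap_iff hxy]; tauto
      have h2 : swap x y ≠ swap v w := by
        rw [Ne, swap_eq_swap_iff hxy]; rcases hv with rfl | rfl <;> tauto
      have h3 : swap y z ≠ swap v w := by
        rw [Ne, swap_eq_swap_iff hyz]; rcases hv with rfl | rfl <;> tauto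
      rw [swap_comm y x] at hyx2
      simp only [List.mem_cons, List.not_mem_nil, or_false]
      rintro t (rfl | rfl | rfl | rfl | rfl) <;>
        simp [h1, h2, h3, h1.symm, h2.symm, h3.symm] <;>
        first | omega | exact List.count_pos_iff.1 hvw)
    have hn : [x, y, z, w].Nodup := by simp; tauto
    rcases hv with rfl | rfl
    · exact not_conjInvariant_of_adjacent_doubled_end hn r (hu.of_perm hr)
    · exact not_conjInvariant_of_adjacent_doubled_middle hn r (hu.of_perm hr)
  rcases hv with rfl | rfl | rfl
  · exact key v z v hx.symm hz hxz (Or.inl rfl) hw.1 hw.2.1 hw.2.2 hyx hyz hvw1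
  · exact key x z v hx.symm hz hxz (Or.inr rfl) hw.1 hw.2.1 hw.2.2 hyx hyz hvw1
  · exact key v x v hz.symm hx (Ne.symm hxz) (Or.inl rfl) hw.2.2 hw.2.1 hw.1 hyz hyx hvw1

/-- The star may be listed in any order and the rest `r` rearranged freely, so cyclic symmetry gives
all six separations for every product from `r`. This is the form that is later contradicted by a
good choice of order. -/
theorem ConjInvariant.not_sameCycle_of_star_of_count (hu : ConjInvariant u) {b x y z : V}
    (hn : [b, x, y, z].Nodup) (h1 : swap b x ∈ u) (h2 : swap b y ∈ u) (h3 : swap b z ∈ u) :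
    ∃ r, u.Perm (swap b x :: swap b y :: swap b z :: r) ∧
      (∀ t, u.count t = [swap b x, swap b y, swap b z].count t + r.count t) ∧
      ∀ l : List (Perm V), l.Perm r → ¬ l.prod.SameCycle b x ∧ ¬ l.prod.SameCycle b y ∧
        ¬ l.prod.SameCycle b z ∧ ¬ l.prod.SameCycle x y ∧ ¬ l.prod.SameCycle x z ∧
        ¬ l.prod.SameCycle y z := by
  have hn' := hn
  simp only [List.nodup_cons, List.mem_cons, List.not_mem_nil, not_or, or_false] at hn'
  obtain ⟨⟨hbx, hby, hbz⟩, ⟨hxy, hxz⟩, hyz, -⟩ := hn'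
  obtain ⟨r, hr, hcount⟩ := exists_perm_append_of_count_le
      (l := [swap b x, swap b y, swap b z]) (u := u) (by
    have e1 : swap b x ≠ swap b y := by rw [Ne, swap_eq_swap_iff hbx]; tauto
    have e2 : swap b x ≠ swap b z := by rw [Ne, swap_eq_swap_iff hbx]; tauto
    have e3 : swap b y ≠ swap b z := by rw [Ne, swap_eq_swap_iff hby]; tauto
    simp only [List.mem_cons, List.not_mem_nil, or_false]
    rintro t (rfl | rfl | rfl) <;>
      simpa [List.count_cons, e1, e2, e3, e1.symm, e2.symm, e3.symm])
  refine ⟨r, hr, hcount, fun l hl => ?_⟩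
  have hu' : ∀ σ : List (Perm V), σ.Perm [swap b x, swap b y, swap b z] → ConjInvariant (σ ++ l) :=
    fun σ hσ => hu.of_perm (hr.trans (hσ.symm.append hl.symm))
  have k1 := (hu' [swap b x, swap b y, swap b z] (List.Perm.refl _)).not_sameCycle_of_star hn
  have k2 := (hu' [swap b y, swap b z, swap b x] (by
    exact (List.perm_append_comm (l₁ := [swap b y, swap b z]) (l₂ := [swap b x])))).not_sameCycle_of_star
      (b := b) (x := y) (y := z) (z := x) (by simp; tauto)
  have k3 := (hu' [swap b z, swap b x, swap b y] (by
    exact (List.perm_append_comm (l₁ := [swap b z]) (l₂ := [swap b x, swap b y])))).not_sameCycle_of_star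
      (b := b) (x := z) (y := x) (z := y) (by simp; tauto)
  exact ⟨k1.1, k2.1, k3.1, k1.2, fun h => k3.2 h.symm, k2.2⟩

end PermSeq

/-! ### Necessity: no circuit of odd multiplicities -/

namespace PermSeq

variable {V : Type*} [DecidableEq V] {u : List (Perm V)}

theorem transpositional_of_perm_append {l r : List (Perm V)} (hu : Transpositional u)
    (h : u.Perm (l ++ r)) : Transpositional r :=
  fun t ht => hu t (h.symm.subset (List.mem_append_right _ ht))

variable [Fintype V]

theorem mem_oddTerms {t : Perm V} : t ∈ oddTerms u ↔ Odd (u.count t) := by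
  rw [← List.count_pos_iff, count_oddTerms]
  split_ifs <;> simp_all

theorem mem_parityReduced {t : Perm V} : t ∈ parityReduced u ↔ t ∈ u := by
  rw [← List.count_pos_iff, count_parityReduced]
  split_ifs <;> simp_all

theorem transpositional_parityReduced (hu : Transpositional u) :
    Transpositional (parityReduced u) := fun t ht => hu t (mem_parityReduced.1 ht)

theorem transpositional_oddTerms (hu : Transpositional u) :
    Transpositional (oddTerms u) := fun t ht => hu t (List.count_pos_iff.1 (mem_oddTerms.1 ht).pos)

/-- Multiplicities are lowered as far as parity allows while `t` is kept. At most `t` remains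
repeated, as the path argument needs. -/
theorem ConjInvariant.append_oddTerms (hu : ConjInvariant u) (hs : Transpositional u) {t : Perm V}
    (ht : t ∈ u) : ∃ v, ConjInvariant v ∧ Transpositional v ∧ t ∈ v ∧
      (∀ s ∈ oddTerms u, s ∈ v) ∧ (∀ s, s ≠ t → v.count s ≤ 1) ∧ v.count t ≤ 2 ∧
      ∀ s ∈ v, s ∈ u := by
  by_cases h : Odd (u.count t)
  · refine ⟨oddTerms u, hu.of_count_le hs (fun s => ?_) fun s => ?_, transpositional_oddTerms hs,
      mem_oddTerms.2 h,
      fun s hs => hs, fun s _ => ?_, ?_, fun s hs => ?_⟩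
    · rw [count_oddTerms]; split_ifs with h1
      exacts [h1.pos, Nat.zero_le _]
    · rw [count_oddTerms]; split_ifs with h1
      exacts [(Nat.odd_iff.1 h1).symm, (Nat.not_odd_iff.1 h1).symm]
    · rw [count_oddTerms]; split_ifs <;> simp
    · rw [count_oddTerms]; split_ifs; simp
    · exact List.count_pos_iff.1 (mem_oddTerms.1 hs).pos
  · have hpos := List.count_pos_iff.2 ht
    rw [Nat.not_odd_iff_even] at h
    have h0 : (oddTerms u).count t = 0 := by
      rw [count_oddTerms, if_neg (Nat.not_odd_iff_even.2 h)]
    have hct : ∀ s, (t :: t :: oddTerms u).count s =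
        if s = t then 2 else (oddTerms u).count s := fun s => by
      split_ifs with hst
      · subst hst; simp [h0]
      · simp [Ne.symm hst]
    refine ⟨t :: t :: oddTerms u, hu.of_count_le hs (fun s => ?_) fun s => ?_, ?_, by simp,
      fun s hs => by simp [hs], fun s hst => ?_, ?_, fun s hsv => ?_⟩
    · rw [hct]; split_ifs with hst
      · subst hst
        obtain ⟨k, hk⟩ := h
        omega
      · rw [count_oddTerms]; split_ifs with h1
        exacts [h1.pos, Nat.zero_le _]
    · rw [hct]; split_ifs with hst
      · subst hst; rw [Nat.even_iff.1 h]
      · rw [count_oddTerms]; split_ifs with h1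
        exacts [(Nat.odd_iff.1 h1).symm, (Nat.not_odd_iff.1 h1).symm]
    · intro s hsv
      simp only [List.mem_cons, or_self_left] at hsv
      rcases hsv with rfl | hsv
      exacts [hs _ ht, (transpositional_oddTerms hs) s hsv]
    · rw [hct, if_neg hst, count_oddTerms]; split_ifs <;> simp
    · rw [hct, if_pos rfl]
    · simp only [List.mem_cons, or_self_left] at hsv
      rcases hsv with rfl | hsv
      exacts [ht, List.count_pos_iff.1 (mem_oddTerms.1 hsv).pos]

/-- If a conjugacy invariant sequence has a circuit of terms of odd multiplicity, then every vertex
on the circuit has just two neighbours. -/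
theorem ConjInvariant.false_of_three_neighbors (hu : ConjInvariant u) (hs : Transpositional u)
    {G : SimpleGraph V} {b x y z : V} (hn : [b, x, y, z].Nodup) (p : G.Walk x y) (hp : p.IsPath)
    (hb : b ∉ p.support) (hx : Odd (u.count (swap b x))) (hy : Odd (u.count (swap b y)))
    (hz : swap b z ∈ u) (hpu : ∀ d ∈ p.darts, Odd (u.count (swap d.fst d.snd))) : False := by
  have hn' := hn
  simp only [List.nodup_cons, List.mem_cons, List.not_mem_nil, not_or, or_false] at hn'
  obtain ⟨⟨hbx, hby, hbz⟩, ⟨hxy, hxz⟩, hyz, -⟩ := hn'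
  obtain ⟨v, hv, hvs, hzv, hov, hv1, -, -⟩ := hu.append_oddTerms hs hz
  obtain ⟨r, hr, hcount, hl⟩ := hv.not_sameCycle_of_star_of_count hn
    (hov _ (mem_oddTerms.2 hx)) (hov _ (mem_oddTerms.2 hy)) hzv
  have hrs : Transpositional r :=
    transpositional_of_perm_append (l := [swap b x, swap b y, swap b z]) hvs hr
  -- The only term that may be repeated is `swap b z`, which does not touch `y`; so the arc of the
  -- circuit brings `x` and `y` together against the star at `b`.
  obtain ⟨l, hlr, hlxy⟩ := exists_perm_sameCycle_of_path p hp hxy r hrs (fun w hw => by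
    have h1 := hv1 (swap w y) (by rw [Ne, swap_eq_swap_iff hw]; tauto)
    have h2 := hcount (swap w y)
    omega) (fun d hd => by
    have h1 : 0 < v.count (swap d.fst d.snd) :=
      List.count_pos_iff.2 (hov _ (mem_oddTerms.2 (hpu d hd)))
    have hd1 : b ≠ d.fst := fun e => hb (e ▸ p.dart_fst_mem_support_of_mem_darts hd)
    have hd2 : b ≠ d.snd := fun e => hb (e ▸ p.dart_snd_mem_support_of_mem_darts hd)
    rw [hcount, List.count_eq_zero_of_not_mem, zero_add] at h1
    · exact List.count_pos_iff.1 h1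
    · simp only [List.mem_cons, List.not_mem_nil, or_false, not_or, eq_comm (a := swap d.fst d.snd)]
      rw [swap_eq_swap_iff hbx, swap_eq_swap_iff hby, swap_eq_swap_iff hbz]
      tauto)
  exact (hl l hlr).2.2.2.1 hlxy

/-- No vertex of the circuit has a third neighbour, so a triangle would be a whole component. In a
longer circuit, three consecutive edges can be set apart: the remaining terms fix the two inner
vertices and, suitably ordered, join the two outer ones, contradicting `not_conjInvariant_of_path`.
-/
theorem ConjInvariant.false_of_odd_cycle (hu : ConjInvariant u) (hs : Transpositional u)
    (hc : (transpositionalMultigraph u).Connected) (hV : 4 ≤ Fintype.card V) {v : V}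
    {c : (transpositionalMultigraph u).toSimpleGraph.Walk v v} (hcyc : c.IsCycle)
    (hodd : ∀ a b, s(a, b) ∈ c.edges → Odd (u.count (swap a b))) : False := by
  have hdeg : ∀ b ∈ c.support, ∀ x y z, s(b, x) ∈ c.edges → s(b, y) ∈ c.edges → x ≠ y →
      (transpositionalMultigraph u).toSimpleGraph.Adj b z → z = x ∨ z = y := by
    intro b hb x y z hbx hby hxy hbz
    obtain ⟨x', y', p, hp, hbp, hxy', hbx', hby', hiff, hd, -⟩ := hcyc.exists_isPath_of_mem_support hb
    by_contra! hz
    have hz' : z ≠ x' ∧ z ≠ y' := by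
      rcases (hiff x).1 hbx with rfl | rfl <;> rcases (hiff y).1 hby with rfl | rfl <;> tauto
    refine hu.false_of_three_neighbors hs (b := b) (x := x') (y := y') (z := z) ?_ p hp hbp
      (hodd _ _ ((hiff x').2 (Or.inl rfl))) (hodd _ _ ((hiff y').2 (Or.inr rfl)))
      (transpositionalMultigraph_adj.1 hbz).2 (fun d hdp => hodd _ _ (hd d hdp))
    have := hbx'.ne
    have := hby'.ne
    have := hbz.ne
    simp
    tauto
  obtain ⟨x, y, p, hp, hbp, hxy, hbx, hby, hiff, hd, hps⟩ :=
    hcyc.exists_isPath_of_mem_support c.start_mem_support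
  have hvx := (hiff x).2 (Or.inl rfl)
  have hvy := (hiff y).2 (Or.inr rfl)
  have hxc := hps x p.start_mem_support
  have hyc := hps y p.end_mem_support
  match p, hp with
  | .nil, _ => exact hxy rfl
  | .cons (v := w) hxw p, hp =>
    rw [SimpleGraph.Walk.cons_isPath_iff] at hp
    have hxw' : s(x, w) ∈ c.edges := hd ⟨(x, w), hxw⟩ (by simp)
    have hwp := p.start_mem_support
    have hwv : w ≠ v := fun e => hbp (by simp [← e])
    rw [Sym2.eq_swap] at hvx hvy
    by_cases hwy : w = y
    -- The circuit is a triangle closed under adjacency, which is impossible with a fourth vertex in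
    -- a connected graph.
    · subst hwy
      obtain ⟨z, hz⟩ := exists_ne_of_four_le_card hV v x w
      rw [Sym2.eq_swap] at hvx hvy
      have hmem := hc.mem_of_forall_adj (S := {a | a = v ∨ a = x ∨ a = w}) (x := v) (by simp)
        (fun a ha b hab => by
          simp only [Set.mem_ofPred_eq] at ha ⊢
          rcases ha with rfl | rfl | rfl
          · have := hdeg a c.start_mem_support x w b hvx hvy hxy hab
            tauto
          · rw [Sym2.eq_swap] at hvx
            have := hdeg a hxc v w b hvx hxw' hwv.symm hab
            tauto
          · rw [Sym2.eq_swap] at hvy hxw'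
            have := hdeg a hyc v x b hvy hxw' hbx.ne hab
            tauto) z
      simp only [Set.mem_ofPred_eq] at hmem
      tauto
    -- Now `w x v y` is a path on the circuit. After passing to `oddTerms u`, where each term occurs
    -- once, nothing else touches `x` or `v`, and the rest of the circuit leads from `w` to `y`.
    · have hwx : w ≠ x := hxw.ne'
      have hn : [w, x, v, y].Nodup := by
        have := hbx.ne
        have := hby.ne
        simp
        tauto
      set o := oddTerms u with ho
      have hoc : ConjInvariant o := hu.of_count_le hs (fun s => by
          rw [ho, count_oddTerms]; split_ifs with h1
          exacts [h1.pos, Nat.zero_le _]) (fun s => by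
          rw [ho, count_oddTerms]; split_ifs with h1
          exacts [(Nat.odd_iff.1 h1).symm, (Nat.not_odd_iff.1 h1).symm])
      have ho1 : ∀ t, o.count t ≤ 1 := fun t => by
        rw [ho, count_oddTerms]; split_ifs <;> simp
      have hmem : ∀ {a b}, s(a, b) ∈ c.edges → 0 < o.count (swap a b) := fun h =>
        List.count_pos_iff.2 (mem_oddTerms.2 (hodd _ _ h))
      have e1 : swap w x ≠ swap x v := by
        rw [Ne, swap_eq_swap_iff hwx]; tauto
      have e2 : swap w x ≠ swap v y := by
        rw [Ne, swap_eq_swap_iff hwx]; tauto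
      have e3 : swap x v ≠ swap v y := by
        have := hbx.ne
        rw [Ne, swap_eq_swap_iff hbx.ne']; tauto
      obtain ⟨r, hr, hcount⟩ := exists_perm_append_of_count_le
          (l := [swap w x, swap x v, swap v y]) (u := o) (by
        have h1 := hmem hxw'
        have h2 := hmem hvx
        have h3 := hmem hvy
        rw [List.count_pos_iff] at h1 h2 h3
        rw [swap_comm] at h1 h3
        simp only [List.mem_cons, List.not_mem_nil, or_false]
        rintro t (rfl | rfl | rfl) <;>
          simpa [e1, e2, e3, e1.symm, e2.symm, e3.symm])
      have hrs : Transpositional r := transpositional_of_perm_append (transpositional_oddTerms hs) hr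
      have hrmem : ∀ t ∈ r, t ∈ u ∧ t ∉ [swap w x, swap x v, swap v y] := fun t ht => by
        have h1 := List.count_pos_iff.2 ht
        have h2 := hcount t
        have h3 := ho1 t
        refine ⟨List.count_pos_iff.1 ?_, fun h4 => ?_⟩
        · have h5 : 0 < o.count t := by omega
          exact (mem_oddTerms.1 (List.count_pos_iff.1 h5)).pos
        · have := List.count_pos_iff.2 h4
          omega
      have hxr : ∀ t ∈ r, t x = x := fun t ht => by
        by_contra hne
        have h1 := IsSwap.eq_swap_apply (hrs t ht) hne
        obtain ⟨htu, hnot⟩ := hrmem t ht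
        have h2 : t x = v ∨ t x = w := hdeg x hxc v w (t x) hvx hxw' hwv.symm
          (transpositionalMultigraph_adj.2 ⟨Ne.symm hne, h1 ▸ htu⟩)
        rcases h2 with h2 | h2 <;> rw [h2] at h1 <;> rw [h1] at hnot <;> simp [swap_comm] at hnot
      have hvr : ∀ t ∈ r, t v = v := fun t ht => by
        by_contra hne
        have h1 := IsSwap.eq_swap_apply (hrs t ht) hne
        obtain ⟨htu, hnot⟩ := hrmem t ht
        rw [Sym2.eq_swap] at hvx hvy
        have h2 : t v = x ∨ t v = y := hdeg v c.start_mem_support x y (t v) hvx hvy hxy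
          (transpositionalMultigraph_adj.2 ⟨Ne.symm hne, h1 ▸ htu⟩)
        rcases h2 with h2 | h2 <;> rw [h2] at h1 <;> rw [h1] at hnot <;> simp [swap_comm] at hnot
      obtain ⟨l, hlr, hwyl⟩ := exists_perm_sameCycle_of_path p hp.1 hwy r hrs (fun z _ => by
        have h1 := ho1 (swap z y)
        have h2 := hcount (swap z y)
        omega) (fun d hdp => by
        have h1 := hmem (hd d (by simp [hdp]))
        have hdx1 : x ≠ d.fst := fun e => hp.2 (e ▸ p.dart_fst_mem_support_of_mem_darts hdp)
        have hdx2 : x ≠ d.snd := fun e => hp.2 (e ▸ p.dart_snd_mem_support_of_mem_darts hdp)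
        have hdv1 : v ≠ d.fst := fun e =>
          hbp (by simp [e, p.dart_fst_mem_support_of_mem_darts hdp])
        have hdv2 : v ≠ d.snd := fun e =>
          hbp (by simp [e, p.dart_snd_mem_support_of_mem_darts hdp])
        rw [hcount, List.count_eq_zero_of_not_mem, zero_add] at h1
        · exact List.count_pos_iff.1 h1
        · simp only [List.mem_cons, List.not_mem_nil, or_false, not_or,
            eq_comm (a := swap d.fst d.snd)]
          rw [swap_eq_swap_iff hwx, swap_eq_swap_iff hbx.ne', swap_eq_swap_iff hby.ne]
          tauto)
      refine not_conjInvariant_of_path hn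
        (prod_apply_eq_self fun t ht => hxr t (hlr.subset ht))
        (prod_apply_eq_self fun t ht => hvr t (hlr.subset ht)) hwyl
        (hoc.of_perm (hr.trans (hlr.symm.append_left _)))

end PermSeq

/-! ### Necessity: no even multiedge on a circuit, hence no circuit -/

namespace PermSeq

variable {V : Type*} [Fintype V] [DecidableEq V] {u : List (Perm V)}

theorem count_eq_one_of_nonsimpleDisjoint (hd : (transpositionalMultigraph u).NonsimpleDisjoint)
    {x y z : V} (hxy : x ≠ y) (hxz : x ≠ z) (hyz : y ≠ z) (h : 2 ≤ u.count (swap x y))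
    (hz : swap x z ∈ u) : u.count (swap x z) = 1 := by
  have h1 := List.count_pos_iff.2 hz
  by_contra h2
  refine hyz (hd x y z ?_ ?_) <;> unfold LooplessMultigraph.IsNonsimpleMultiedge
  · rwa [transpositionalMultigraph_mult hxy]
  · rw [transpositionalMultigraph_mult hxz]; omega

theorem count_parityReduced_of_even {t : Perm V} (h : Even (u.count t)) (ht : t ∈ u) :
    (parityReduced u).count t = 2 := by
  rw [count_parityReduced, if_pos ht, if_pos h]

theorem count_parityReduced_le_one {t : Perm V} (h : u.count t ≤ 1) :
    (parityReduced u).count t ≤ 1 := by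
  rw [count_parityReduced]
  split_ifs with h1 h2
  · have := List.count_pos_iff.2 h1
    rw [show u.count t = 1 by omega] at h2
    exact absurd h2 (by decide)
  · exact le_rfl
  · exact Nat.zero_le _

theorem count_le_one_of_nonsimpleDisjoint (hd : (transpositionalMultigraph u).NonsimpleDisjoint)
    {x y z : V} (hxy : x ≠ y) (hxz : x ≠ z) (hyz : y ≠ z) (h : 2 ≤ u.count (swap x y)) :
    u.count (swap x z) ≤ 1 := by
  by_cases hz : swap x z ∈ u
  · exact (count_eq_one_of_nonsimpleDisjoint hd hxy hxz hyz h hz).le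
  · rw [List.count_eq_zero_of_not_mem hz]; exact Nat.zero_le _

theorem two_le_of_even_count {t : Perm V} (h : Even (u.count t)) (ht : t ∈ u) :
    2 ≤ u.count t := by
  have := List.count_pos_iff.2 ht
  obtain ⟨k, hk⟩ := h
  omega

/-- A repeated term of even multiplicity lies on no circuit. -/
theorem ConjInvariant.false_of_even_on_circuit (hu : ConjInvariant u) (hs : Transpositional u)
    (hd : (transpositionalMultigraph u).NonsimpleDisjoint) {G : SimpleGraph V} {x y c : V}
    (hcx : c ≠ x) (p : G.Walk c x) (hp : p.IsPath) (hyp : y ∉ p.support)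
    (heven : Even (u.count (swap y x))) (he : swap y x ∈ u) (hyc : swap y c ∈ u)
    (hpu : ∀ d ∈ p.darts, swap d.fst d.snd ∈ u) : False := by
  have hyx : y ≠ x := fun e => hyp (e ▸ p.end_mem_support)
  have hyc' : y ≠ c := fun e => hyp (e ▸ p.start_mem_support)
  have he2 := two_le_of_even_count heven he
  have hv := conjInvariant_parityReduced hu hs
  have hvs : Transpositional (parityReduced u) := transpositional_parityReduced hs
  have hve := count_parityReduced_of_even heven he
  have hvx : ∀ z, z ≠ y → z ≠ x → (parityReduced u).count (swap z x) ≤ 1 := fun z hzy hzx => by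
    rw [swap_comm]
    exact count_parityReduced_le_one
      (count_le_one_of_nonsimpleDisjoint hd hyx.symm hzx.symm hzy.symm (by rwa [swap_comm]))
  have hvy : ∀ z, z ≠ y → z ≠ x → (parityReduced u).count (swap y z) ≤ 1 := fun z hzy hzx =>
    count_parityReduced_le_one (count_le_one_of_nonsimpleDisjoint hd hyx hzy.symm hzx.symm he2)
  have hdart : ∀ d ∈ p.darts, y ≠ d.fst ∧ y ≠ d.snd := fun d hdp =>
    ⟨fun e => hyp (e ▸ p.dart_fst_mem_support_of_mem_darts hdp),
      fun e => hyp (e ▸ p.dart_snd_mem_support_of_mem_darts hdp)⟩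
  -- With a third neighbour `z` the star at `y` gives the contradiction; without one, all terms at
  -- `y` are the two copies of `swap y x` and the one of `swap y c`.
  by_cases hdeg : ∃ z, swap y z ∈ u ∧ z ≠ x ∧ z ≠ c ∧ z ≠ y
  · obtain ⟨z, hyz, hzx, hzc, hzy⟩ := hdeg
    have hn : [y, x, c, z].Nodup := by simp; tauto
    obtain ⟨r, hr, hcount, hl⟩ := hv.not_sameCycle_of_star_of_count hn
      (mem_parityReduced.2 he) (mem_parityReduced.2 hyc) (mem_parityReduced.2 hyz)
    have hrs : Transpositional r :=
      transpositional_of_perm_append (l := [swap y x, swap y c, swap y z]) hvs hr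
    have hstar : ∀ t : Perm V, t y = y → [swap y x, swap y c, swap y z].count t = 0 := fun t ht => by
      refine List.count_eq_zero_of_not_mem fun h => ?_
      simp only [List.mem_cons, List.not_mem_nil, or_false] at h
      rcases h with rfl | rfl | rfl <;> rw [swap_apply_left] at ht <;> tauto
    have hecount : [swap y x, swap y c, swap y z].count (swap y x) = 1 := by
      have e1 : swap y c ≠ swap y x := by rw [Ne, swap_eq_swap_iff hyc']; tauto
      have e2 : swap y z ≠ swap y x := by rw [Ne, swap_eq_swap_iff hzy.symm]; tauto
      simp [e1, e2]
    have her : r.count (swap y x) = 1 := by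
      have := hcount (swap y x)
      omega
    have hmem : swap y x ∈ r := List.count_pos_iff.1 (by omega)
    -- The star takes one copy of `swap y x`. The other is set aside while the arc joins `c` to `x`,
    -- which clears the repeated term from the end `x` of the path.
    obtain ⟨l, hlr, hlcx⟩ := exists_perm_sameCycle_of_path p hp hcx (r.erase (swap y x))
      (fun t ht => hrs t (List.mem_of_mem_erase ht)) (fun w hwx => by
        by_cases hwy : w = y
        · subst hwy
          rw [List.count_erase_self, her]
          exact Nat.zero_le _
        · have h1 := hvx w hwy hwx
          have h2 := hcount (swap w x)
          have h3 := (List.erase_sublist (a := swap y x) (l := r)).count_le (swap w x)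
          omega) (fun d hdp => by
        obtain ⟨hd1, hd2⟩ := hdart d hdp
        have h1 := List.count_pos_iff.2 (mem_parityReduced.2 (hpu d hdp))
        rw [hcount, hstar _ (swap_apply_of_ne_of_ne hd1 hd2), zero_add] at h1
        rw [List.mem_erase_of_ne]
        · exact List.count_pos_iff.1 h1
        · rw [ne_comm, Ne, swap_eq_swap_iff hyx]
          tauto)
    obtain ⟨h1, h2, -, h3, -, -⟩ := hl (l ++ [swap y x])
      (List.perm_append_comm.trans ((hlr.cons _).trans (List.perm_cons_erase hmem).symm))
    rw [List.prod_append, List.prod_singleton] at h1 h2 h3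
    -- Putting the copy back either splits the cycle of `c` and `x`, leaving `c` with `x` or with
    -- `y`, or merges `y` with `x`; the star forbids each outcome.
    by_cases hs : l.prod.SameCycle y x
    · have := (sameCycle_of_sameCycle_mul_swap hyx hs c x).1 hlcx
      rcases this with h | ⟨h | h, -⟩
      exacts [h3 h.symm, h2 h, h3 h]
    · exact h1 ((sameCycle_mul_swap_iff hs y x).2
        (Or.inr ⟨Or.inl (Perm.SameCycle.refl _ _), Or.inr (Perm.SameCycle.refl _ _)⟩))
  · push Not at hdeg
    have e1 : swap x y ≠ swap y c := by rw [Ne, swap_eq_swap_iff hyx.symm]; tauto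
    obtain ⟨r, hr, hcount⟩ := exists_perm_append_of_count_le
        (l := [swap x y, swap x y, swap y c]) (u := parityReduced u) (by
      have h1 := List.count_pos_iff.2 (mem_parityReduced.2 hyc)
      rw [swap_comm] at hve
      simp only [List.mem_cons, List.not_mem_nil, or_false]
      rintro t (rfl | rfl | rfl) <;>
        simp only [List.count_cons, List.count_nil, beq_iff_eq, e1, e1.symm, if_true, if_false] <;>
        omega)
    have hrs : Transpositional r := transpositional_of_perm_append hvs hr
    have hry : ∀ t ∈ r, t y = y := fun t ht => by
      by_contra hne
      have h1 := IsSwap.eq_swap_apply (hrs t ht) hne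
      have h2 : swap y (t y) ∈ u := by
        rw [← h1, ← mem_parityReduced, ← List.count_pos_iff, hcount]
        have := List.count_pos_iff.2 ht
        omega
      have h3 : t y = x ∨ t y = c := by
        by_contra! h
        exact hne (hdeg _ h2 h.1 h.2)
      have h4 := hcount t
      have h5 := List.count_pos_iff.2 ht
      rcases h3 with h3 | h3 <;> rw [h3] at h1
      · rw [swap_comm] at h1 hve
        rw [h1] at h4 h5
        simp only [List.count_cons, List.count_nil, beq_iff_eq, e1.symm, if_true, if_false] at h4
        omega
      · have := hvy c hyc'.symm hcx
        rw [h1] at h4 h5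
        simp only [List.count_cons, List.count_nil, beq_iff_eq, e1, if_true, if_false] at h4
        omega
    obtain ⟨l, hlr, hlcx⟩ := exists_perm_sameCycle_of_path p hp hcx r hrs (fun w hwx => by
        by_cases hwy : w = y
        · subst hwy
          rw [List.count_eq_zero_of_not_mem fun h => ?_]
          · exact Nat.zero_le _
          · have := hry _ h
            rw [swap_apply_left] at this
            exact hyx this.symm
        · have h1 := hvx w hwy hwx
          have h2 := hcount (swap w x)
          omega) (fun d hdp => by
        obtain ⟨hd1, hd2⟩ := hdart d hdp
        have h1 := List.count_pos_iff.2 (mem_parityReduced.2 (hpu d hdp))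
        rw [hcount, List.count_eq_zero_of_not_mem, zero_add] at h1
        · exact List.count_pos_iff.1 h1
        · simp only [List.mem_cons, List.not_mem_nil, or_false, not_or,
            eq_comm (a := swap d.fst d.snd)]
          rw [swap_eq_swap_iff hyx.symm, swap_eq_swap_iff hyc']
          tauto)
    refine not_conjInvariant_of_doubled_circuit (x := x) (y := y) (c := c) (by simp; tauto)
      (prod_apply_eq_self fun t ht => hry t (hlr.subset ht)) hlcx.symm
      (hv.of_perm (hr.trans (hlr.symm.append_left _)))

/-- A circuit either contains a multiedge of even multiplicity or consists of odd ones, and both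
kinds are excluded. -/
theorem ConjInvariant.isAcyclic (hu : ConjInvariant u) (hs : Transpositional u)
    (hc : (transpositionalMultigraph u).Connected) (hV : 4 ≤ Fintype.card V) :
    (transpositionalMultigraph u).toSimpleGraph.IsAcyclic := by
  intro v c hcyc
  have hd := hu.nonsimpleDisjoint hc hV
  refine hu.false_of_odd_cycle hs hc hV hcyc fun a b hab => ?_
  by_contra heven
  rw [Nat.not_odd_iff_even] at heven
  have hadj : ∀ {a b}, s(a, b) ∈ c.edges → swap a b ∈ u := fun h =>
    (transpositionalMultigraph_adj.1 (c.adj_of_mem_edges h)).2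
  obtain ⟨x, y, p, hp, hap, hxy, hax, hay, hiff, hdp, -⟩ :=
    hcyc.exists_isPath_of_mem_support (c.fst_mem_support_of_mem_edges hab)
  have hpu : ∀ d ∈ p.darts, swap d.fst d.snd ∈ u := fun d hd => hadj (hdp d hd)
  have hax' := hadj ((hiff x).2 (Or.inl rfl))
  have hay' := hadj ((hiff y).2 (Or.inr rfl))
  rcases (hiff b).1 hab with rfl | rfl
  · refine hu.false_of_even_on_circuit hs hd (y := a) hxy.symm p.reverse hp.reverse (by simpa) heven
      hax' hay' fun d hd => ?_
    rw [SimpleGraph.Walk.darts_reverse, List.mem_reverse, List.mem_map] at hd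
    obtain ⟨d', hd', rfl⟩ := hd
    rw [swap_comm]
    exact hpu d' hd'
  · exact hu.false_of_even_on_circuit hs hd (y := a) hxy p hp hap heven hay' hax' hpu

end PermSeq

/-! ### Necessity: even multiedges are twigs -/

namespace PermSeq

variable {V : Type*} [Fintype V] [DecidableEq V] {u : List (Perm V)}

theorem reachable_mono {r v : List (Perm V)} (h : ∀ t ∈ r, t ∈ v) {x y : V}
    (hr : (transpositionalMultigraph r).toSimpleGraph.Reachable x y) :
    (transpositionalMultigraph v).toSimpleGraph.Reachable x y := by
  refine hr.mono fun a b hab => ?_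
  rw [transpositionalMultigraph_adj] at *
  exact ⟨hab.1, h _ hab.2⟩

/-- Every edge of a forest is a bridge. -/
theorem not_reachable_of_isAcyclic (ha : (transpositionalMultigraph u).toSimpleGraph.IsAcyclic)
    {x y : V} (hxy : x ≠ y) (he : swap x y ∈ u) {r : List (Perm V)} (hr : ∀ t ∈ r, t ∈ u)
    (her : swap x y ∉ r) : ¬ (transpositionalMultigraph r).toSimpleGraph.Reachable x y := by
  intro h
  have hb := SimpleGraph.isAcyclic_iff_forall_adj_isBridge.1 ha
    (transpositionalMultigraph_adj.2 ⟨hxy, he⟩)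
  rw [SimpleGraph.isBridge_iff] at hb
  refine hb (h.mono fun a b hab => ?_)
  rw [transpositionalMultigraph_adj] at hab
  rw [SimpleGraph.deleteEdges_adj, transpositionalMultigraph_adj]
  refine ⟨⟨hab.1, hr _ hab.2⟩, fun hs => her ?_⟩
  have : swap a b = swap x y := by
    rw [swap_eq_swap_iff hab.1]
    simpa using hs
  exact this ▸ hab.2

/-- After parity reduction the four removed terms use up every copy of the three multiedges. These
are bridges, so the remaining product keeps the four vertices on distinct cycles, as
`not_conjInvariant_of_doubled_middle` requires. -/
theorem ConjInvariant.false_of_even_middle (hu : ConjInvariant u) (hs : Transpositional u)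
    (hd : (transpositionalMultigraph u).NonsimpleDisjoint)
    (ha : (transpositionalMultigraph u).toSimpleGraph.IsAcyclic) {x y c d : V} (hxy : x ≠ y)
    (hyc : y ≠ c) (hxd : x ≠ d) (hcx : c ≠ x) (hdy : d ≠ y) (heven : Even (u.count (swap x y)))
    (he : swap x y ∈ u) (hc : swap y c ∈ u) (hdu : swap x d ∈ u) : False := by
  have he2 := two_le_of_even_count heven he
  have hv := conjInvariant_parityReduced hu hs
  have hvs : Transpositional (parityReduced u) := transpositional_parityReduced hs
  have hve := count_parityReduced_of_even heven he
  have hvc : (parityReduced u).count (swap y c) ≤ 1 := count_parityReduced_le_one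
    (count_le_one_of_nonsimpleDisjoint hd hxy.symm hyc hcx.symm (by rwa [swap_comm]))
  have hvd : (parityReduced u).count (swap x d) ≤ 1 := count_parityReduced_le_one
    (count_le_one_of_nonsimpleDisjoint hd hxy hxd hdy.symm he2)
  set r' := u.filter (· ≠ swap x y) with hr'
  have hr'mem : ∀ {t}, t ∈ r' ↔ t ∈ u ∧ t ≠ swap x y := by simp [hr']
  have e1 : swap y c ≠ swap x y := by rw [Ne, swap_eq_swap_iff hyc]; tauto
  have e2 : swap x d ≠ swap x y := by rw [Ne, swap_eq_swap_iff hxd]; tauto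
  have e3 : swap y c ≠ swap x d := by rw [Ne, swap_eq_swap_iff hyc]; tauto
  have hnot := not_reachable_of_isAcyclic ha hxy he (r := r') (fun t ht => (hr'mem.1 ht).1)
    (fun h => (hr'mem.1 h).2 rfl)
  have hyc1 : (transpositionalMultigraph r').toSimpleGraph.Reachable c y :=
    (SimpleGraph.Adj.reachable
      (transpositionalMultigraph_adj.2 ⟨hyc, hr'mem.2 ⟨hc, e1⟩⟩)).symm
  have hxd1 : (transpositionalMultigraph r').toSimpleGraph.Reachable x d :=
    SimpleGraph.Adj.reachable (transpositionalMultigraph_adj.2 ⟨hxd, hr'mem.2 ⟨hdu, e2⟩⟩)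
  have hcd : c ≠ d := by
    rintro rfl
    exact hnot (hxd1.trans hyc1)
  obtain ⟨r, hr, hcount⟩ := exists_perm_append_of_count_le
      (l := [swap x y, swap x y, swap y c, swap x d]) (u := parityReduced u) (by
    have h1 := List.count_pos_iff.2 (mem_parityReduced.2 hc)
    have h2 := List.count_pos_iff.2 (mem_parityReduced.2 hdu)
    simp only [List.mem_cons, List.not_mem_nil, or_false]
    rintro t (rfl | rfl | rfl | rfl) <;>
      simp only [List.count_cons, List.count_nil, beq_iff_eq, e1, e1.symm, e2, e2.symm, e3, e3.symm,
        if_true, if_false] <;>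
      omega)
  have hrs : Transpositional r := transpositional_of_perm_append hvs hr
  have hru : ∀ t ∈ r, t ∈ u := fun t ht =>
    mem_parityReduced.1 (hr.symm.subset (List.mem_append_right _ ht))
  have hcount' := hcount
  simp only [List.count_cons, List.count_nil, beq_iff_eq] at hcount'
  have hre : swap x y ∉ r := fun h => by
    have h1 := hcount' (swap x y)
    have h2 := List.count_pos_iff.2 h
    simp only [if_true] at h1
    omega
  have hrc : swap y c ∉ r := fun h => by
    have h1 := hcount' (swap y c)
    have h2 := List.count_pos_iff.2 h
    simp only [if_true] at h1
    omega
  have hrd : swap x d ∉ r := fun h => by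
    have h1 := hcount' (swap x d)
    have h2 := List.count_pos_iff.2 h
    simp only [if_true] at h1
    omega
  have hrr' : ∀ t ∈ r, t ∈ r' := fun t ht => hr'mem.2 ⟨hru t ht, fun h => hre (h ▸ ht)⟩
  have key : ∀ a b, r.prod.SameCycle a b →
      (transpositionalMultigraph r').toSimpleGraph.Reachable a b := fun a b h =>
    reachable_mono hrr' (reachable_of_sameCycle_prod hrs h)
  refine not_conjInvariant_of_doubled_middle (x := x) (y := y) (c := c) (d := d)
    (by simp; tauto) ?_ (hv.of_perm hr)
  simp only [List.pairwise_cons, List.mem_cons, List.not_mem_nil, or_false, forall_eq_or_imp,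
    forall_eq]
  refine ⟨⟨fun h => hnot (key _ _ h), fun h => hnot ((key _ _ h).trans hyc1), fun h => ?_⟩,
    ⟨fun h => ?_, fun h => hnot (hxd1.trans (key _ _ h).symm)⟩,
    fun h => hnot (hxd1.trans ((key _ _ h).symm.trans hyc1)), by simp, List.Pairwise.nil⟩
  · exact not_reachable_of_isAcyclic ha hxd hdu hru hrd (reachable_of_sameCycle_prod hrs h)
  · exact not_reachable_of_isAcyclic ha hyc hc hru hrc (reachable_of_sameCycle_prod hrs h)

/-- The star at `y` uses one of the two copies of `swap y x`. The other copy, a bridge applied last,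
merges the cycles of `y` and `x`, which the star forbids. -/
theorem ConjInvariant.false_of_even_at_branch (hu : ConjInvariant u) (hs : Transpositional u)
    (ha : (transpositionalMultigraph u).toSimpleGraph.IsAcyclic) {x y c d : V}
    (hn : [y, x, c, d].Nodup) (heven : Even (u.count (swap y x)))
    (he : swap y x ∈ u) (hc : swap y c ∈ u) (hdu : swap y d ∈ u) : False := by
  have hn' := hn
  simp only [List.nodup_cons, List.mem_cons, List.not_mem_nil, not_or, or_false] at hn'
  obtain ⟨⟨hyx, hyc, hyd⟩, ⟨hxc, hxd⟩, hcd, -⟩ := hn'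
  have hv := conjInvariant_parityReduced hu hs
  have hvs : Transpositional (parityReduced u) := transpositional_parityReduced hs
  have hve := count_parityReduced_of_even heven he
  obtain ⟨r, hr, hcount, hl⟩ := hv.not_sameCycle_of_star_of_count hn
    (mem_parityReduced.2 he) (mem_parityReduced.2 hc) (mem_parityReduced.2 hdu)
  have hrs : Transpositional r :=
    transpositional_of_perm_append (l := [swap y x, swap y c, swap y d]) hvs hr
  have hecount : [swap y x, swap y c, swap y d].count (swap y x) = 1 := by
    have e1 : swap y c ≠ swap y x := by rw [Ne, swap_eq_swap_iff hyc]; tauto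
    have e2 : swap y d ≠ swap y x := by rw [Ne, swap_eq_swap_iff hyd]; tauto
    simp [e1, e2]
  have her : r.count (swap y x) = 1 := by
    have := hcount (swap y x)
    omega
  have hmem : swap y x ∈ r := List.count_pos_iff.1 (by omega)
  refine (hl (r.erase (swap y x) ++ [swap y x])
    (List.perm_append_comm.trans (List.perm_cons_erase hmem).symm)).1 ?_
  rw [List.prod_append, List.prod_singleton, sameCycle_mul_swap_iff]
  · exact Or.inr ⟨Or.inl (Perm.SameCycle.refl _ _), Or.inr (Perm.SameCycle.refl _ _)⟩
  · intro h
    refine not_reachable_of_isAcyclic ha hyx he (r := r.erase (swap y x)) (fun t ht => ?_) ?_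
      (reachable_of_sameCycle_prod (fun t ht => hrs t (List.mem_of_mem_erase ht)) h)
    · exact mem_parityReduced.1 (hr.symm.subset
        (List.mem_append_right [swap y x, swap y c, swap y d] (List.mem_of_mem_erase ht)))
    · rw [← List.count_pos_iff, List.count_erase_self, her]
      omega

theorem ConjInvariant.evenMultiedgesAreTwigs (hu : ConjInvariant u) (hs : Transpositional u)
    (hc : (transpositionalMultigraph u).Connected) (hV : 4 ≤ Fintype.card V) :
    (transpositionalMultigraph u).EvenMultiedgesAreTwigs := by
  have hd := hu.nonsimpleDisjoint hc hV
  have ha := hu.isAcyclic hs hc hV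
  have key : ∀ x y c : V, (transpositionalMultigraph u).IsMultiedge x y →
      Even (u.count (swap x y)) → (transpositionalMultigraph u).IsMultiedge y c → c ≠ x →
      (transpositionalMultigraph u).IsMultitwig x y ∧
        ((transpositionalMultigraph u).neighbors y).ncard = 2 := by
    intro x y c hxy heven hyc hcx
    obtain ⟨hxy', hxyu⟩ := transpositionalMultigraph_isMultiedge.1 hxy
    obtain ⟨hyc', hycu⟩ := transpositionalMultigraph_isMultiedge.1 hyc
    constructor
    · ext d
      simp only [LooplessMultigraph.neighbors, Set.mem_ofPred_eq, Set.mem_singleton_iff]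
      refine ⟨fun hxd => ?_, fun h => h ▸ hxy⟩
      obtain ⟨hxd', hxdu⟩ := transpositionalMultigraph_isMultiedge.1 hxd
      by_contra hdy
      exact hu.false_of_even_middle hs hd ha hxy' hyc' hxd' hcx hdy heven hxyu hycu hxdu
    · rw [Set.ncard_eq_two]
      refine ⟨x, c, hcx.symm, ?_⟩
      ext d
      simp only [LooplessMultigraph.neighbors, Set.mem_ofPred_eq, Set.mem_insert_iff,
        Set.mem_singleton_iff]
      rw [swap_comm] at heven hxyu
      refine ⟨fun hyd => ?_, ?_⟩
      · obtain ⟨hyd', hydu⟩ := transpositionalMultigraph_isMultiedge.1 hyd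
        by_contra! hdxc
        exact hu.false_of_even_at_branch hs ha (x := x) (y := y) (c := c) (d := d)
          (by simp; tauto) heven hxyu hycu hydu
      · rintro (rfl | rfl)
        · exact transpositionalMultigraph_isMultiedge.2 ⟨hxy'.symm, hxyu⟩
        · exact hyc
  intro x y hxy heven
  obtain ⟨hxy', hxyu⟩ := transpositionalMultigraph_isMultiedge.1 hxy
  rw [transpositionalMultigraph_mult hxy'] at heven
  by_cases h1 : ∃ c, (transpositionalMultigraph u).IsMultiedge y c ∧ c ≠ x
  · obtain ⟨c, hc1, hc2⟩ := h1
    exact Or.inl (key x y c hxy heven hc1 hc2)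
  · by_cases h2 : ∃ c, (transpositionalMultigraph u).IsMultiedge x c ∧ c ≠ y
    · obtain ⟨c, hc1, hc2⟩ := h2
      rw [swap_comm] at heven hxyu
      exact Or.inr (key y x c (transpositionalMultigraph_isMultiedge.2 ⟨hxy'.symm, hxyu⟩)
        heven hc1 hc2)
    -- Otherwise `{x, y}` is closed under adjacency, against connectedness with four vertices.
    · push Not at h1 h2
      obtain ⟨z, hzx, hzy, -⟩ := exists_ne_of_four_le_card hV x y y
      have := hc.mem_of_forall_adj (S := {a | a = x ∨ a = y}) (x := x) (by simp)
        (fun a ha b hab => by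
          simp only [Set.mem_ofPred_eq] at ha ⊢
          rcases ha with rfl | rfl
          exacts [Or.inr (h2 b hab), Or.inl (h1 b hab)]) z
      simp only [Set.mem_ofPred_eq] at this
      tauto

end PermSeq

/-! ### Sufficiency: good multigraphs -/

/-- The cycle type is the multiset of sizes of the non-singleton orbits, so the partition into
orbits determines it. -/
theorem Equiv.Perm.isConj_of_sameCycle_iff {V : Type*} [Fintype V] [DecidableEq V] {g h : Perm V}
    (hgh : ∀ x y, g.SameCycle x y ↔ h.SameCycle x y) : IsConj g h := by
  classical
  rw [Perm.isConj_iff_cycleType_eq]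
  have himage : ∀ f : Perm V, f.cycleFactorsFinset.image Perm.support =
      (Finset.univ.filter fun x => ∃ y, y ≠ x ∧ f.SameCycle x y).image
        fun x => Finset.univ.filter fun y => f.SameCycle x y := by
    intro f
    have hmoved : ∀ x, f x ≠ x ↔ ∃ y, y ≠ x ∧ f.SameCycle x y := fun x =>
      ⟨fun hx => ⟨f x, hx, Perm.sameCycle_apply_right.2 (Perm.SameCycle.refl _ _)⟩,
        fun ⟨y, hy, hxy⟩ hx => hy (hxy.eq_of_left hx).symm⟩
    have hsupp : ∀ x, f x ≠ x → (f.cycleOf x).support =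
        Finset.univ.filter fun y => f.SameCycle x y := fun x hx => by
      ext y
      rw [Perm.mem_support_cycleOf_iff' hx]
      simp
    ext s
    simp only [Finset.mem_image, Finset.mem_filter, Finset.mem_univ, true_and, ← hmoved]
    constructor
    · rintro ⟨c, hc, rfl⟩
      obtain ⟨x, hx⟩ := (Perm.mem_cycleFactorsFinset_iff.1 hc).1.nonempty_support
      have hcx := Perm.cycle_is_cycleOf hx hc
      have hfx : f x ≠ x := Perm.mem_support.1 (Perm.mem_cycleFactorsFinset_support_le hc hx)
      exact ⟨x, hfx, by rw [hcx, hsupp x hfx]⟩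
    · rintro ⟨x, hx, rfl⟩
      exact ⟨f.cycleOf x, Perm.cycleOf_mem_cycleFactorsFinset_iff.2 (Perm.mem_support.2 hx),
        hsupp x hx⟩
  have htype : ∀ f : Perm V,
      f.cycleType = (f.cycleFactorsFinset.image Perm.support).val.map Finset.card := by
    intro f
    -- Distinct cycle factors have distinct supports, so the set of supports loses no multiplicity.
    rw [Perm.cycleType_def, Finset.image_val_of_injOn, Multiset.map_map]
    intro c hc d hd hcd
    obtain ⟨x, hx⟩ := (Perm.mem_cycleFactorsFinset_iff.1 hc).1.nonempty_support
    rw [Perm.cycle_is_cycleOf hx hc, Perm.cycle_is_cycleOf (hcd ▸ hx) hd]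
  rw [htype, htype, himage, himage]
  simp only [hgh]

namespace PermSeq

variable {V : Type*}

/-- A cyclic rotation moves `s` to the end. The conjugator is kept as a product of terms because it
then preserves components. -/
theorem isConj_prod_of_mem {l : List (Perm V)} {s : Perm V} (hs : s ∈ l) :
    ∃ m, l.Perm (s :: m) ∧ ∃ c : Perm V, (∃ l' : List (Perm V), (∀ t ∈ l', t ∈ l) ∧ c = l'.prod) ∧
      c * l.prod * c⁻¹ = m.prod * s := by
  obtain ⟨A, B, rfl⟩ := List.append_of_mem hs
  refine ⟨B ++ A, List.perm_middle.trans (List.perm_append_comm.cons s), B.prod,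
    ⟨B, fun t ht => by simp [ht], rfl⟩, ?_⟩
  simp only [List.prod_append, List.prod_cons]
  group

variable [DecidableEq V]

theorem commute_swap_of_apply_eq {t : Perm V} {x y : V} (hx : t x = x) (hy : t y = y) :
    Commute t (swap x y) := by
  rw [Commute, SemiconjBy, Equiv.mul_swap_eq_swap_mul, hx, hy]

theorem prod_eq_prod_filter_mul_pow [Fintype V] {e : Perm V} {m : List (Perm V)}
    (h : ∀ t ∈ m, Commute t e) : m.prod = (m.filter (· ≠ e)).prod * e ^ m.count e := by
  induction m with
  | nil => simp
  | cons t m ih =>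
    have ih' := ih fun s hs => h s (List.mem_cons_of_mem _ hs)
    by_cases hte : t = e
    · subst hte
      have hc : Commute t (m.filter (· ≠ t)).prod :=
        (Commute.list_prod_left _ _ fun s hs =>
          h s (List.mem_cons_of_mem _ (List.mem_of_mem_filter hs))).symm
      rw [List.prod_cons, ih', List.filter_cons_of_neg (by simp), List.count_cons_self, pow_succ',
        ← mul_assoc, hc.eq, mul_assoc]
    · rw [List.prod_cons, ih', List.filter_cons_of_pos (by simpa), List.prod_cons,
        List.count_cons_of_ne hte, mul_assoc]

variable [Fintype V]

/-- Rotate the exceptional term `s` of an even term `e` to the end. Everything before it commutes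
with `e`, so the copies of `e` gather into an even power, which is trivial. Repeat until only odd
multiplicities remain. -/
theorem exists_isConj_prod_odd {u : List (Perm V)} (hs : Transpositional u)
    (hu : ∀ e ∈ u, Even (u.count e) → ∃ s ∈ u, s ≠ e ∧ u.count s = 1 ∧
      ∀ t ∈ u, t ≠ s → Commute t e) {l : List (Perm V)} (hl : l.Perm u) :
    ∃ l' : List (Perm V), l'.Perm (u.filter fun t => Odd (u.count t)) ∧ IsConj l.prod l'.prod := by
  induction hn : u.length using Nat.strong_induction_on generalizing u l with
  | _ n ih =>
    by_cases he : ∃ e ∈ u, Even (u.count e)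
    · obtain ⟨e, heu, heven⟩ := he
      obtain ⟨s, hsu, hse, hs1, hcomm⟩ := hu e heu heven
      obtain ⟨m, hm, c, -, hc⟩ := isConj_prod_of_mem (hl.symm.subset hsu)
      have hmu : (s :: m).Perm u := hm.symm.trans hl
      have hms : s ∉ m := fun h => by
        have h1 := hmu.count_eq s
        rw [List.count_cons_self, hs1] at h1
        have := List.count_pos_iff.2 h
        omega
      have hprod : m.prod = (m.filter (· ≠ e)).prod := by
        have hme : m.count e = u.count e := by
          rw [← hmu.count_eq, List.count_cons_of_ne hse]
        obtain ⟨k, hk⟩ := heven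
        rw [prod_eq_prod_filter_mul_pow (e := e) fun t ht =>
          hcomm t (hmu.subset (List.mem_cons_of_mem _ ht)) fun h => hms (h ▸ ht), hme, hk,
          ← two_mul, pow_mul, pow_two, isSwap_mul_self (hs e heu), one_pow, mul_one]
      set u' := u.filter (· ≠ e) with hu'
      have hcount : ∀ t, t ≠ e → u'.count t = u.count t := fun t ht =>
        List.count_filter (by simpa using ht)
      have hmem : ∀ t, t ∈ u' → t ∈ u ∧ t ≠ e := fun t ht => by simpa [hu'] using ht
      have hperm : (m.filter (· ≠ e) ++ [s]).Perm u' := by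
        have := hmu.filter (· ≠ e)
        rw [List.filter_cons_of_pos (by simpa)] at this
        exact List.perm_append_comm.trans this
      have hlen : u'.length < n := by
        rw [← hn]
        exact List.length_filter_lt_length_iff_exists.2 ⟨e, heu, by simp⟩
      obtain ⟨l', hl', hconj⟩ := ih _ hlen (u := u') (fun t ht => hs t (hmem t ht).1)
        (fun f hf hfe => by
          obtain ⟨hfu, hfe'⟩ := hmem f hf
          rw [hcount f hfe'] at hfe
          obtain ⟨r, hr, hrf, hr1, hrc⟩ := hu f hfu hfe
          have hre : r ≠ e := fun h => by
            rw [← h, hr1] at heven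
            exact absurd heven (by decide)
          exact ⟨r, by simp [hu', hr, hre], hrf, by rw [hcount r hre, hr1],
            fun t ht htr => hrc t (hmem t ht).1 htr⟩) hperm rfl
      refine ⟨l', hl'.trans (List.Perm.of_eq ?_), ?_⟩
      · rw [hu', List.filter_filter]
        refine List.filter_congr fun t ht => ?_
        by_cases hte : t = e
        · subst hte
          simpa using heven
        · have := hcount t hte
          simp only [hu', ne_eq, decide_not] at this
          simp [hte, this]
      · refine IsConj.trans (isConj_iff.2 ⟨c, hc⟩) ?_
        rw [hprod]
        simpa using hconj
    · push Not at he
      refine ⟨l, hl.trans (List.Perm.of_eq ?_), IsConj.refl _⟩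
      rw [List.filter_eq_self.2]
      intro t ht
      simpa using he t ht

/-- Adding an edge merges components in the same way as `sameCycle_mul_swap_iff` merges cycles; the
parallel form drives the induction on forests. -/
theorem reachable_cons_swap_iff {m : List (Perm V)} {a b : V} (hab : a ≠ b) (x y : V) :
    (transpositionalMultigraph (swap a b :: m)).toSimpleGraph.Reachable x y ↔
      (transpositionalMultigraph m).toSimpleGraph.Reachable x y ∨
      (((transpositionalMultigraph m).toSimpleGraph.Reachable a x ∨
        (transpositionalMultigraph m).toSimpleGraph.Reachable b x) ∧
      ((transpositionalMultigraph m).toSimpleGraph.Reachable a y ∨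
        (transpositionalMultigraph m).toSimpleGraph.Reachable b y)) := by
  set R := (transpositionalMultigraph m).toSimpleGraph.Reachable with hR
  have hRs : ∀ {x y}, R x y → R y x := fun h => SimpleGraph.Reachable.symm h
  have hRt : ∀ {x y z}, R x y → R y z → R x z := fun h h' => SimpleGraph.Reachable.trans h h'
  constructor
  · rintro ⟨p⟩
    induction p with
    | nil => exact Or.inl (.refl _)
    | @cons x v y h p ih =>
      rw [transpositionalMultigraph_adj, List.mem_cons] at h
      obtain ⟨hxv, h | h⟩ := h
      · rw [swap_eq_swap_iff hxv] at h
        have ha : R a a := .refl _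
        have hb : R b b := .refl _
        rcases h with ⟨rfl, rfl⟩ | ⟨rfl, rfl⟩ <;> tauto
      · have hxv' : R x v := SimpleGraph.Adj.reachable (transpositionalMultigraph_adj.2 ⟨hxv, h⟩)
        rcases ih with ih | ⟨ih | ih, ih'⟩
        · exact Or.inl (hRt hxv' ih)
        · exact Or.inr ⟨Or.inl (hRt ih (hRs hxv')), ih'⟩
        · exact Or.inr ⟨Or.inr (hRt ih (hRs hxv')), ih'⟩
  · have hmono : ∀ {x y}, R x y →
        (transpositionalMultigraph (swap a b :: m)).toSimpleGraph.Reachable x y := fun h =>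
      reachable_mono (fun t ht => List.mem_cons_of_mem _ ht) h
    have hab' : (transpositionalMultigraph (swap a b :: m)).toSimpleGraph.Reachable a b :=
      SimpleGraph.Adj.reachable (transpositionalMultigraph_adj.2 ⟨hab, List.mem_cons_self⟩)
    rintro (h | ⟨h | h, h' | h'⟩)
    · exact hmono h
    · exact (hmono h).symm.trans (hmono h')
    · exact (hmono h).symm.trans (hab'.trans (hmono h'))
    · exact (hmono h).symm.trans (hab'.symm.trans (hmono h'))
    · exact (hmono h).symm.trans (hmono h')

/-- A term occurring once can be rotated to the end, where, being a bridge, it merges two cycles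
just as it merges two components. When no such term is left all terms commute, and two copies of one
can be cancelled; oddness keeps its edge present. -/
theorem sameCycle_prod_iff_reachable {l : List (Perm V)} (hs : Transpositional l)
    (ha : (transpositionalMultigraph l).toSimpleGraph.IsAcyclic)
    (hodd : ∀ t ∈ l, Odd (l.count t))
    (hcomm : ∀ t ∈ l, ∀ s ∈ l, 2 ≤ l.count t → 2 ≤ l.count s → Commute t s) (x y : V) :
    l.prod.SameCycle x y ↔ (transpositionalMultigraph l).toSimpleGraph.Reachable x y := by
  induction hn : l.length using Nat.strong_induction_on generalizing l x y with
  | _ n ih =>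
    have hanti : ∀ {m : List (Perm V)}, (∀ t ∈ m, t ∈ l) →
        (transpositionalMultigraph m).toSimpleGraph.IsAcyclic := fun {m} hm =>
      ha.anti fun a b hab => by
        rw [transpositionalMultigraph_adj] at *
        exact ⟨hab.1, hm _ hab.2⟩
    by_cases hsimple : ∃ s ∈ l, l.count s = 1
    · obtain ⟨s, hsl, hs1⟩ := hsimple
      obtain ⟨m, hm, c, ⟨l', hl', hcl'⟩, hc⟩ := isConj_prod_of_mem hsl
      have hml : ∀ t ∈ m, t ∈ l := fun t ht => hm.symm.subset (List.mem_cons_of_mem _ ht)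
      have hsm : s ∉ m := fun h => by
        have h1 := hm.count_eq s
        have h2 := List.count_pos_iff.2 h
        rw [List.count_cons_self, hs1] at h1
        omega
      have hcount : ∀ t ∈ m, m.count t = l.count t := fun t ht => by
        rw [hm.count_eq, List.count_cons_of_ne]
        rintro rfl
        exact hsm ht
      have hih := ih m.length (by rw [← hn, hm.length_eq]; simp) (l := m)
        (fun t ht => hs t (hml t ht)) (hanti hml)
        (fun t ht => by rw [hcount t ht]; exact hodd t (hml t ht))
        (fun t ht r hr h1 h2 => hcomm t (hml t ht) r (hml r hr) (by rwa [← hcount t ht])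
          (by rwa [← hcount r hr])) (hn := rfl)
      obtain ⟨a, b, hab, rfl⟩ := hs s hsl
      have hnot : ¬ m.prod.SameCycle a b := by
        rw [hih]
        exact not_reachable_of_isAcyclic ha hab hsl hml hsm
      have hconj : l.prod.SameCycle x y ↔ (m.prod * swap a b).SameCycle (c x) (c y) := by
        rw [← hc, Perm.sameCycle_conj]
        simp
      have hreach : ∀ z w, (transpositionalMultigraph l).toSimpleGraph.Reachable z w ↔
          (transpositionalMultigraph (swap a b :: m)).toSimpleGraph.Reachable z w := fun z w =>
        ⟨reachable_mono fun t ht => hm.subset ht, reachable_mono fun t ht => hm.symm.subset ht⟩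
      -- The rotation conjugates by a product of terms, which moves no point out of its component.
      have hcx : ∀ z, (transpositionalMultigraph l).toSimpleGraph.Reachable z (c z) := fun z => by
        rw [hcl']
        exact reachable_prod_apply hs hl' z
      rw [hconj, sameCycle_mul_swap_iff hnot]
      simp only [hih]
      rw [← reachable_cons_swap_iff hab, ← hreach]
      exact ⟨fun h => (hcx x).trans (h.trans (hcx y).symm),
        fun h => (hcx x).symm.trans (h.trans (hcx y))⟩
    · push Not at hsimple
      have h2 : ∀ t ∈ l, 2 ≤ l.count t := fun t ht => by
        have h1 := hsimple t ht
        have := List.count_pos_iff.2 ht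
        omega
      rcases l with _ | ⟨e, l₁⟩
      · simp only [List.prod_nil]
        constructor
        · intro h
          rw [h.eq_of_left rfl]
        · rintro ⟨p⟩
          cases p with
          | nil => exact Perm.SameCycle.refl _ _
          | cons h _ => exact absurd (transpositionalMultigraph_adj.1 h).2 List.not_mem_nil
      · have hel := h2 e List.mem_cons_self
        have hel₁ : e ∈ l₁ := by
          rw [List.count_cons_self] at hel
          exact List.count_pos_iff.1 (by omega)
        have hperm : (e :: l₁).Perm (e :: e :: l₁.erase e) := (List.perm_cons_erase hel₁).cons e
        have hprod : (e :: l₁).prod = (l₁.erase e).prod := by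
          have h1 := hperm.prod_eq' (List.Pairwise.imp_of_mem (R := fun _ _ => True)
            (fun {a b} ha hb _ => hcomm a ha b hb (h2 a ha) (h2 b hb))
            (List.pairwise_of_forall (R := fun _ _ => True) fun _ _ => trivial))
          rw [h1, List.prod_cons, List.prod_cons, ← mul_assoc,
            isSwap_mul_self (hs e List.mem_cons_self), one_mul]
        have hml : ∀ t ∈ l₁.erase e, t ∈ e :: l₁ := fun t ht =>
          List.mem_cons_of_mem _ (List.mem_of_mem_erase ht)
        have hcount : ∀ t, (e :: l₁).count t = (if e = t then 2 else 0) + (l₁.erase e).count t := by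
          intro t
          rw [hperm.count_eq, List.count_cons, List.count_cons]
          simp only [beq_iff_eq]
          split_ifs <;> omega
        -- An odd multiplicity that is at least two is at least three, so one copy survives.
        have hlm : ∀ t ∈ e :: l₁, t ∈ l₁.erase e := fun t ht => by
          have h1 := hodd t ht
          have h3 := hcount t
          rw [← List.count_pos_iff]
          obtain ⟨k, hk⟩ := h1
          have := List.count_pos_iff.2 ht
          split_ifs at h3 <;> omega
        rw [hprod, ih (l₁.erase e).length (by
          rw [← hn, hperm.length_eq]; simp) (l := l₁.erase e)
          (fun t ht => hs t (hml t ht)) (hanti hml) (fun t ht => ?_)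
          (fun t ht s hs _ _ => hcomm t (hml t ht) s (hml s hs) (h2 _ (hml t ht)) (h2 _ (hml s hs)))
          x y rfl]
        · exact ⟨reachable_mono hml, reachable_mono hlm⟩
        · have h1 := hodd t (hml t ht)
          rw [hcount] at h1
          split_ifs at h1
          · rw [Nat.odd_iff] at h1 ⊢; omega
          · simpa using h1

/-- For an even twig with leaf `x`, non-leaf vertex `y` and second neighbour `c` of `y`, the only
term not commuting with it is `swap y c`, and this is simple because non-simple multiedges do not
touch. So every product reduces to one of the odd terms, whose cycles do not depend on their order.
-/
theorem conjInvariant_of_good {u : List (Perm V)} (hs : Transpositional u)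
    (ha : (transpositionalMultigraph u).toSimpleGraph.IsAcyclic)
    (hd : (transpositionalMultigraph u).NonsimpleDisjoint)
    (he : (transpositionalMultigraph u).EvenMultiedgesAreTwigs) : ConjInvariant u := by
  have heven : ∀ e ∈ u, Even (u.count e) → ∃ s ∈ u, s ≠ e ∧ u.count s = 1 ∧
      ∀ t ∈ u, t ≠ s → Commute t e := by
    have key : ∀ x y, swap x y ∈ u → x ≠ y → Even (u.count (swap x y)) →
        (transpositionalMultigraph u).IsMultitwig x y →
        ((transpositionalMultigraph u).neighbors y).ncard = 2 →
        ∃ s ∈ u, s ≠ swap x y ∧ u.count s = 1 ∧ ∀ t ∈ u, t ≠ s → Commute t (swap x y) := by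
      intro x y hxyu hxy heven htwig hcard
      have hnx : ∀ z, x ≠ z → swap x z ∈ u → z = y := fun z hxz hz => by
        have : z ∈ (transpositionalMultigraph u).neighbors x :=
          transpositionalMultigraph_isMultiedge.2 ⟨hxz, hz⟩
        rwa [htwig] at this
      have hxy' : x ∈ (transpositionalMultigraph u).neighbors y :=
        transpositionalMultigraph_isMultiedge.2 ⟨hxy.symm, by rwa [swap_comm]⟩
      obtain ⟨c, hcx, hc⟩ : ∃ c, c ≠ x ∧ (transpositionalMultigraph u).neighbors y = {x, c} := by
        obtain ⟨p, q, hpq, hpq'⟩ := Set.ncard_eq_two.1 hcard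
        rw [hpq'] at hxy' ⊢
        rcases hxy' with rfl | rfl
        · exact ⟨q, hpq.symm, rfl⟩
        · exact ⟨p, hpq, Set.pair_comm _ _⟩
      have hcmem : c ∈ (transpositionalMultigraph u).neighbors y := by rw [hc]; simp
      obtain ⟨hyc, hycu⟩ := transpositionalMultigraph_isMultiedge.1 hcmem
      refine ⟨swap y c, hycu, ?_, ?_, fun t ht hts => ?_⟩
      · rw [Ne, swap_eq_swap_iff hyc]; tauto
      · exact count_eq_one_of_nonsimpleDisjoint hd hxy.symm hyc hcx.symm
          (by rw [swap_comm]; exact two_le_of_even_count heven hxyu) hycu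
      · by_cases htx : t x = x
        · by_cases hty : t y = y
          · exact commute_swap_of_apply_eq htx hty
          · have h1 := IsSwap.eq_swap_apply (hs t ht) hty
            have h2 : t y ∈ (transpositionalMultigraph u).neighbors y :=
              transpositionalMultigraph_isMultiedge.2 ⟨Ne.symm hty, h1 ▸ ht⟩
            rw [hc] at h2
            rcases h2 with h2 | h2 <;> rw [h2] at h1
            · rw [h1, swap_comm]
            · exact absurd h1 hts
        · have h1 := IsSwap.eq_swap_apply (hs t ht) htx
          rw [hnx _ (Ne.symm htx) (h1 ▸ ht)] at h1
          rw [h1]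
    intro e heu heven
    obtain ⟨x, y, hxy, rfl⟩ := hs e heu
    rcases he x y (transpositionalMultigraph_isMultiedge.2 ⟨hxy, heu⟩)
      (by rwa [transpositionalMultigraph_mult hxy]) with ⟨h1, h2⟩ | ⟨h1, h2⟩
    · exact key x y heu hxy heven h1 h2
    · rw [swap_comm] at heu heven ⊢
      exact key y x heu hxy.symm heven h1 h2
  set o := u.filter fun t => Odd (u.count t) with ho
  have homem : ∀ {t}, t ∈ o → t ∈ u ∧ Odd (u.count t) := fun {t} ht => by simpa [ho] using ht
  have hoc : ∀ t ∈ o, o.count t = u.count t := fun t ht =>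
    List.count_filter (by simpa using (homem ht).2)
  have hforest : ∀ m : List (Perm V), m.Perm o → ∀ x y, m.prod.SameCycle x y ↔
      (transpositionalMultigraph o).toSimpleGraph.Reachable x y := by
    intro m hm x y
    rw [sameCycle_prod_iff_reachable (fun t ht => hs t (homem (hm.subset ht)).1) ?_ (fun t ht => ?_)
      (fun t ht s hst h1 h2 => ?_) x y]
    · exact ⟨reachable_mono fun t ht => hm.subset ht, reachable_mono fun t ht => hm.symm.subset ht⟩
    · refine ha.anti fun a b hab => ?_
      rw [transpositionalMultigraph_adj] at *
      exact ⟨hab.1, (homem (hm.subset hab.2)).1⟩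
    · rw [hm.count_eq, hoc t (hm.subset ht)]
      exact (homem (hm.subset ht)).2
    · rw [hm.count_eq, hoc t (hm.subset ht)] at h1
      rw [hm.count_eq, hoc s (hm.subset hst)] at h2
      obtain ⟨x, y, hxy, rfl⟩ := hs s (homem (hm.subset hst)).1
      have htswap := hs t (homem (hm.subset ht)).1
      by_cases hts : t = swap x y
      · rw [hts]
      -- Two different non-simple terms share no vertex, hence commute.
      have key : ∀ a b, swap x y = swap a b → a ≠ b → t a = a := fun a b hab hne => by
        by_contra hta
        have h3 := IsSwap.eq_swap_apply htswap hta
        have h4 : t a = b := by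
          refine hd a _ _ ?_ ?_ <;> unfold LooplessMultigraph.IsNonsimpleMultiedge
          · rw [transpositionalMultigraph_mult (Ne.symm hta), ← h3]
            exact h1
          · rw [transpositionalMultigraph_mult hne, ← hab]
            exact h2
        exact hts (by rw [h3, h4, hab])
      exact commute_swap_of_apply_eq (key x y rfl hxy) (key y x (swap_comm _ _) hxy.symm)
  rw [conjInvariant_iff]
  intro l l' hl hl'
  obtain ⟨m, hm, hlm⟩ := exists_isConj_prod_odd hs heven hl
  obtain ⟨m', hm', hlm'⟩ := exists_isConj_prod_odd hs heven hl'
  refine hlm.trans (IsConj.trans (Perm.isConj_of_sameCycle_iff fun x y => ?_) hlm'.symm)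
  rw [hforest m hm, hforest m' hm']

end PermSeq

/-! ### Small vertex sets and the connected case -/

namespace PermSeq

/-- The sign condition makes the total product even: on three points odd products are all conjugate,
so only the even case can be refuted. -/
theorem triangle_refuted : ∀ h : Perm (Fin 3), Perm.sign h = -1 →
    Refuted [((0 : Fin 3), (1 : Fin 3)), (1, 2), (0, 2)].permutations' h := by
  decide +kernel

theorem doubled_refuted : ∀ h : Perm (Fin 3), Perm.sign h = 1 →
    Refuted [[((0 : Fin 3), (1 : Fin 3)), (0, 1), (1, 2), (1, 2)], [(0, 1), (1, 2), (0, 1), (1, 2)],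
      [(1, 2), (0, 1), (1, 2), (0, 1)]] h := by
  decide +kernel

/-- The odd permutations of three points are the transpositions. -/
theorem isConj_of_sign_eq_neg_one : ∀ g h : Perm (Fin 3), Perm.sign g = -1 → Perm.sign h = -1 →
    ∃ c : Perm (Fin 3), c * g * c⁻¹ = h := by
  decide +kernel

variable {V : Type*} [Fintype V] [DecidableEq V] {u : List (Perm V)}

theorem sign_prod (hs : Transpositional u) : Perm.sign u.prod = (-1) ^ u.length := by
  rw [Perm.sign_prod_list_swap hs]

theorem conjInvariant_of_odd_length (hV : Fintype.card V = 3) (hs : Transpositional u)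
    (hodd : Odd u.length) : ConjInvariant u := by
  have e := Fintype.equivFinOfCardEq hV
  have hsign : ∀ l : List (Perm V), l.Perm u → Perm.sign (e.permCongrHom l.prod) = -1 := by
    intro l hl
    have : Perm.sign (e.permCongrHom l.prod) = Perm.sign l.prod := Perm.sign_permCongr e l.prod
    rw [this, sign_prod fun t ht => hs t (hl.subset ht), hl.length_eq, hodd.neg_one_pow]
  rw [conjInvariant_iff]
  intro l l' hl hl'
  obtain ⟨c, hc⟩ := isConj_of_sign_eq_neg_one _ _ (hsign l hl) (hsign l' hl')
  refine isConj_iff.2 ⟨e.permCongrHom.symm c, e.permCongrHom.injective ?_⟩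
  rw [map_mul, map_mul, map_inv, MulEquiv.apply_symm_apply, hc]

omit [Fintype V] in
theorem exists_eq_map_swap {ι : Type*} [DecidableEq ι] {f : ι ↪ V} (hf : Function.Surjective f)
    {r : List (Perm V)} (hr : Transpositional r) :
    ∃ w : List (ι × ι), r = (w.map fun p => swap (f p.1) (f p.2)) ∧ ∀ p ∈ w, p.1 ≠ p.2 := by
  induction r with
  | nil => exact ⟨[], rfl, by simp⟩
  | cons t r ih =>
    obtain ⟨w, hw, hw'⟩ := ih fun s hs => hr s (List.mem_cons_of_mem _ hs)
    obtain ⟨a, b, hab, rfl⟩ := hr t List.mem_cons_self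
    obtain ⟨i, rfl⟩ := hf a
    obtain ⟨j, rfl⟩ := hf b
    refine ⟨(i, j) :: w, by rw [hw]; rfl, ?_⟩
    rintro p hp
    rcases List.mem_cons.1 hp with rfl | hp
    exacts [fun h => hab (congrArg f h), hw' p hp]

theorem sign_swapProd {ι : Type*} [Fintype ι] [DecidableEq ι] {w : List (ι × ι)}
    (hw : ∀ p ∈ w, p.1 ≠ p.2) : Perm.sign (swapProd w) = (-1) ^ w.length := by
  rw [swapProd, sign_prod, List.length_map]
  intro t ht
  obtain ⟨p, hp, rfl⟩ := List.mem_map.1 ht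
  exact ⟨_, _, hw p hp, rfl⟩

/-- When the embedding is onto, the remaining terms live on `ι` and `q = 1` will do. Their number
fixes the sign of `h`, so only one parity has to be refuted. -/
theorem ConjInvariant.false_of_refuted {ι : Type*} [Fintype ι] [DecidableEq ι] {f : ι ↪ V}
    (hf : Function.Surjective f) {w : List (ι × ι)} {r : List (Perm V)} (hr : Transpositional r)
    (hu : ConjInvariant ((w.map fun p => swap (f p.1) (f p.2)) ++ r)) {W : List (List (ι × ι))}
    (hW : ∀ w' ∈ W, w'.Perm w)
    (href : ∀ h : Perm ι, Perm.sign h = (-1) ^ r.length → Refuted W h) : False := by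
  obtain ⟨w', rfl, hw'⟩ := exists_eq_map_swap hf hr
  refine hu.not_refuted (q := 1) (h := swapProd w') ?_ ?_ hW (href _ ?_)
  · rw [prod_map_swap, one_mul]
  · intro i j hij
    exact f.injective (Perm.sameCycle_one.1 hij)
  · rw [sign_swapProd hw', List.length_map]

theorem length_eq_of_three {x y z : V} (hxy : x ≠ y) (hxz : x ≠ z) (hyz : y ≠ z)
    (hV : ∀ w : V, w = x ∨ w = y ∨ w = z) (hs : Transpositional u) :
    u.length = u.count (swap x y) + u.count (swap x z) + u.count (swap y z) := by
  have e1 : swap x y ≠ swap x z := by rw [Ne, swap_eq_swap_iff hxy]; tauto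
  have e2 : swap x y ≠ swap y z := by rw [Ne, swap_eq_swap_iff hxy]; tauto
  have e3 : swap x z ≠ swap y z := by rw [Ne, swap_eq_swap_iff hxz]; tauto
  induction u with
  | nil => rfl
  | cons t u ih =>
    have ht : t = swap x y ∨ t = swap x z ∨ t = swap y z := by
      obtain ⟨a, b, hab, rfl⟩ := hs t List.mem_cons_self
      rcases hV a with rfl | rfl | rfl <;> rcases hV b with rfl | rfl | rfl <;>
        first
          | exact absurd rfl hab
          | simp [swap_comm]
    rw [List.length_cons, ih fun s hs' => hs s (List.mem_cons_of_mem _ hs')]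
    rcases ht with rfl | rfl | rfl <;>
      simp [e1, e2, e3, e1.symm, e2.symm, e3.symm] <;> omega

theorem exists_third (hV : Fintype.card V = 3) {x y : V} (hxy : x ≠ y) :
    ∃ z, x ≠ z ∧ y ≠ z ∧ ∀ w : V, w = x ∨ w = y ∨ w = z := by
  have hcard : (Finset.univ \ {x, y} : Finset V).card = 1 := by
    rw [Finset.card_sdiff_of_subset (Finset.subset_univ _), Finset.card_univ, hV,
      Finset.card_pair hxy]
  obtain ⟨z, hz⟩ := Finset.card_eq_one.1 hcard
  have hmem : ∀ w, w = z ↔ w ≠ x ∧ w ≠ y := fun w => by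
    have := congrArg (w ∈ ·) hz
    simp at this
    tauto
  have := (hmem z).1 rfl
  refine ⟨z, this.1.symm, this.2.symm, fun w => ?_⟩
  have := hmem w
  tauto

omit [Fintype V] [DecidableEq V] in
theorem tripleEmbedding_surjective {x y z : V} (hn : [x, y, z].Nodup)
    (hV : ∀ w : V, w = x ∨ w = y ∨ w = z) : Function.Surjective (tripleEmbedding hn) := by
  intro w
  rcases hV w with rfl | rfl | rfl
  exacts [⟨0, rfl⟩, ⟨1, rfl⟩, ⟨2, rfl⟩]

/-- Besides the simple multiedge a forest on three vertices has room for one more, and even length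
makes its multiplicity odd. No even multiedge remains, so `conjInvariant_of_good` applies. -/
theorem conjInvariant_of_tree_of_card_three (hV : Fintype.card V = 3) (hs : Transpositional u)
    (heven : Even u.length) (ha : (transpositionalMultigraph u).toSimpleGraph.IsAcyclic) {x y : V}
    (hxy : (transpositionalMultigraph u).IsSimpleMultiedge x y) : ConjInvariant u := by
  have hne : x ≠ y := by
    rintro rfl
    unfold LooplessMultigraph.IsSimpleMultiedge at hxy
    rw [(transpositionalMultigraph u).loopless] at hxy
    omega
  unfold LooplessMultigraph.IsSimpleMultiedge at hxy
  rw [transpositionalMultigraph_mult hne] at hxy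
  have key : ∀ x y z : V, x ≠ y → x ≠ z → y ≠ z → (∀ w : V, w = x ∨ w = y ∨ w = z) →
      u.count (swap x y) = 1 → swap x z ∉ u → ConjInvariant u := by
    intro x y z hne hxz hyz hall hxy hxzu
    have hlen := length_eq_of_three hne hxz hyz hall hs
    rw [hxy, List.count_eq_zero_of_not_mem hxzu, add_zero] at hlen
    have hodd : Odd (u.count (swap y z)) := by
      rw [Nat.odd_iff]
      rw [hlen, Nat.even_iff] at heven
      omega
    have hterm : ∀ a b, swap a b ∈ u → a ≠ b → swap a b = swap x y ∨ swap a b = swap y z := by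
      intro a b hab habne
      rcases hall a with rfl | rfl | rfl <;> rcases hall b with rfl | rfl | rfl <;>
        first
          | exact absurd rfl habne
          | exact absurd hab hxzu
          | exact absurd (by rwa [swap_comm]) hxzu
          | exact Or.inl rfl
          | exact Or.inr rfl
          | exact Or.inl (swap_comm _ _)
          | exact Or.inr (swap_comm _ _)
    refine conjInvariant_of_good hs ha ?_ ?_
    · intro v a b hva hvb
      unfold LooplessMultigraph.IsNonsimpleMultiedge at hva hvb
      have h1 : ∀ a, 2 ≤ (transpositionalMultigraph u).mult v a →
          v ≠ a ∧ swap v a = swap y z := by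
        intro a hva
        have hva' : v ≠ a := by
          rintro rfl
          rw [(transpositionalMultigraph u).loopless] at hva
          omega
        rw [transpositionalMultigraph_mult hva'] at hva
        refine ⟨hva', (hterm v a (List.count_pos_iff.1 (by omega)) hva').resolve_left fun h => ?_⟩
        rw [h, hxy] at hva
        omega
      obtain ⟨h2, h3⟩ := h1 a hva
      obtain ⟨h4, h5⟩ := h1 b hvb
      have := congrArg (fun t : Perm V => t v) (h3.trans h5.symm)
      simpa using this
    · intro a b hab heven
      obtain ⟨habne, habu⟩ := transpositionalMultigraph_isMultiedge.1 hab
      rw [transpositionalMultigraph_mult habne] at heven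
      rcases hterm a b habu habne with h | h <;> rw [h] at heven
      · rw [hxy] at heven
        exact absurd heven (by decide)
      · exact absurd heven (Nat.not_even_iff_odd.2 hodd)
  obtain ⟨z, hxz, hyz, hall⟩ := exists_third hV hne
  by_cases h1 : swap x z ∈ u
  · by_cases h2 : swap y z ∈ u
    · exfalso
      -- If both other pairs occurred, they would bypass the bridge `x y`.
      refine not_reachable_of_isAcyclic ha hne (List.count_pos_iff.1 (by omega))
        (r := [swap x z, swap y z]) (by simp [h1, h2]) ?_ ?_
      · have e1 : swap x y ≠ swap x z := by rw [Ne, swap_eq_swap_iff hne]; tauto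
        have e2 : swap x y ≠ swap y z := by rw [Ne, swap_eq_swap_iff hne]; tauto
        simp [e1, e2]
      · exact (SimpleGraph.Adj.reachable (v := z)
          (transpositionalMultigraph_adj.2 ⟨hxz, by simp⟩)).trans
          (SimpleGraph.Adj.reachable (transpositionalMultigraph_adj.2
            ⟨hyz.symm, by simp [swap_comm]⟩))
    · refine key y x z hne.symm hyz hxz (fun w => ?_) (by rwa [swap_comm]) h2
      have := hall w
      tauto
  · exact key x y z hne hxz hyz hall hxy h1

/-- A circuit is the full triangle; removing its three terms leaves an odd number of terms, the case
of `triangle_refuted`. -/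
theorem ConjInvariant.isAcyclic_of_card_three (hu : ConjInvariant u) (hV : Fintype.card V = 3)
    (hs : Transpositional u) (heven : Even u.length) :
    (transpositionalMultigraph u).toSimpleGraph.IsAcyclic := by
  intro v c hcyc
  obtain ⟨x, y, p, hp, hvp, hxy, hvx, hvy, -⟩ :=
    hcyc.exists_isPath_of_mem_support c.start_mem_support
  obtain ⟨z, hvz, hxz, hall⟩ := exists_third hV hvx.ne
  have hyz : y = z := by
    have := hall y
    have := hvy.ne'
    tauto
  subst hyz
  have hxyu : swap x y ∈ u := by
    match p, hp with
    | .nil, _ => exact absurd rfl hxy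
    | .cons (v := w) h p, hp =>
      have hw : w = y := by
        have h1 := hall w
        have h2 : w ≠ v := fun e => hvp (by simp [← e])
        have h3 := h.ne'
        tauto
      exact hw ▸ (transpositionalMultigraph_adj.1 h).2
  have hn : [v, x, y].Nodup := by
    have := hvx.ne
    have := hvy.ne
    simp
    tauto
  have e1 : swap v x ≠ swap x y := by rw [Ne, swap_eq_swap_iff hvx.ne]; tauto
  have e2 : swap v x ≠ swap v y := by rw [Ne, swap_eq_swap_iff hvx.ne]; tauto
  have e3 : swap x y ≠ swap v y := by rw [Ne, swap_eq_swap_iff hxy]; have := hvx.ne; tauto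
  have hvxu := (transpositionalMultigraph_adj.1 hvx).2
  have hvyu := (transpositionalMultigraph_adj.1 hvy).2
  obtain ⟨r, hr, -⟩ := exists_perm_append_of_count_le
      (l := [swap v x, swap x y, swap v y]) (u := u) (by
    simp only [List.mem_cons, List.not_mem_nil, or_false]
    rintro t (rfl | rfl | rfl) <;>
      simpa [e1, e2, e3, e1.symm, e2.symm, e3.symm])
  refine ConjInvariant.false_of_refuted (w := [(0, 1), (1, 2), (0, 2)])
    (W := [(0, 1), (1, 2), (0, 2)].permutations')
    (tripleEmbedding_surjective hn hall) (transpositional_of_perm_append hs hr) (hu.of_perm hr)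
    (fun w hw => List.mem_permutations'.1 hw) fun h hh => triangle_refuted h ?_
  have hlen := hr.length_eq
  rw [List.length_append, show [swap v x, swap x y, swap v y].length = 3 from rfl] at hlen
  rw [hh]
  refine Odd.neg_one_pow ?_
  rw [Nat.even_iff] at heven
  rw [Nat.odd_iff]
  omega

/-- Without a simple multiedge, connectedness supplies two touching multiedges that are both
repeated, and `doubled_refuted` applies to the even remainder. -/
theorem ConjInvariant.exists_isSimpleMultiedge_of_card_three (hu : ConjInvariant u)
    (hV : Fintype.card V = 3) (hs : Transpositional u) (heven : Even u.length)
    (hc : (transpositionalMultigraph u).Connected) :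
    ∃ x y, (transpositionalMultigraph u).IsSimpleMultiedge x y := by
  by_contra! hno
  have hnt : Nontrivial V := Fintype.one_lt_card_iff_nontrivial.1 (by omega)
  have h2 : ∀ {x y}, x ≠ y → swap x y ∈ u → 2 ≤ u.count (swap x y) := fun {x y} hxy h => by
    have h1 := hno x y
    unfold LooplessMultigraph.IsSimpleMultiedge at h1
    rw [transpositionalMultigraph_mult hxy] at h1
    have := List.count_pos_iff.2 h
    omega
  have key : ∀ x y z : V, x ≠ y → x ≠ z → y ≠ z → (∀ w : V, w = x ∨ w = y ∨ w = z) →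
      swap x y ∈ u → swap y z ∈ u → False := by
    intro x y z hxy hxz hyz hall hxyu hyzu
    have hn : [x, y, z].Nodup := by simp; tauto
    have e1 : swap x y ≠ swap y z := by rw [Ne, swap_eq_swap_iff hxy]; tauto
    obtain ⟨r, hr, -⟩ := exists_perm_append_of_count_le
        (l := [swap x y, swap x y, swap y z, swap y z]) (u := u) (by
      have h1 := h2 hxy hxyu
      have h3 := h2 hyz hyzu
      simp only [List.mem_cons, List.not_mem_nil, or_false]
      rintro t (rfl | rfl | rfl | rfl) <;>
        simpa [e1, e1.symm])
    refine ConjInvariant.false_of_refuted (w := [(0, 1), (0, 1), (1, 2), (1, 2)])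
      (tripleEmbedding_surjective hn hall) (transpositional_of_perm_append hs hr) (hu.of_perm hr)
      ?_ fun h hh => doubled_refuted h ?_
    · decide
    have hlen := hr.length_eq
    rw [List.length_append,
      show [swap x y, swap x y, swap y z, swap y z].length = 4 from rfl] at hlen
    rw [hh]
    refine Even.neg_one_pow ?_
    rw [Nat.even_iff] at heven ⊢
    omega
  obtain ⟨x⟩ : Nonempty V := inferInstance
  obtain ⟨y, hxy⟩ := hc.preconnected.exists_adj_of_nontrivial x
  obtain ⟨z, hxz, hyz, hall⟩ := exists_third hV hxy.ne
  obtain ⟨w, hzw⟩ := hc.preconnected.exists_adj_of_nontrivial z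
  have hxyu := (transpositionalMultigraph_adj.1 hxy).2
  have hzwu := (transpositionalMultigraph_adj.1 hzw).2
  rw [swap_comm] at hzwu
  rcases hall w with rfl | rfl | rfl
  · rw [swap_comm] at hxyu
    refine key y w z hxy.ne' hyz hxz (fun w => ?_) hxyu hzwu
    have := hall w
    tauto
  · exact key x w z hxy.ne hxz hyz hall hxyu hzwu
  · exact hzw.ne rfl

theorem conjInvariant_iff_of_card_three (hV : Fintype.card V = 3) (hs : Transpositional u)
    (hc : (transpositionalMultigraph u).Connected) :
    ConjInvariant u ↔ Odd u.length ∨ ((transpositionalMultigraph u).IsMultitree ∧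
      ∃ x y, (transpositionalMultigraph u).IsSimpleMultiedge x y) := by
  by_cases hodd : Odd u.length
  · simp [hodd, conjInvariant_of_odd_length hV hs hodd]
  · rw [Nat.not_odd_iff_even] at hodd
    constructor
    · intro hu
      exact Or.inr ⟨⟨hc, hu.isAcyclic_of_card_three hV hs hodd⟩,
        hu.exists_isSimpleMultiedge_of_card_three hV hs hodd hc⟩
    · rintro (h | ⟨h, x, y, hxy⟩)
      · exact absurd hodd (Nat.not_even_iff_odd.2 h)
      · exact conjInvariant_of_tree_of_card_three hV hs hodd h.isAcyclic hxy

theorem conjInvariant_iff_of_four_le_card (hV : 4 ≤ Fintype.card V) (hs : Transpositional u)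
    (hc : (transpositionalMultigraph u).Connected) :
    ConjInvariant u ↔ (transpositionalMultigraph u).IsMultitree ∧
      (transpositionalMultigraph u).NonsimpleDisjoint ∧
      (transpositionalMultigraph u).EvenMultiedgesAreTwigs :=
  ⟨fun hu => ⟨⟨hc, hu.isAcyclic hs hc hV⟩, hu.nonsimpleDisjoint hc hV,
    hu.evenMultiedgesAreTwigs hs hc hV⟩,
    fun ⟨h1, h2, h3⟩ => conjInvariant_of_good hs h1.isAcyclic h2 h3⟩

/-- The group is commutative of order two, so there is a single product, and both cosets of the
trivial alternating group are singletons. -/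
theorem permComplete_and_conjInvariant_fin_two (u : List (Perm (Fin 2))) :
    PermComplete u ∧ ConjInvariant u := by
  have hcomm : ∀ a b : Perm (Fin 2), Commute a b := by
    unfold Commute SemiconjBy
    decide
  have hprod : ∀ l l' : List (Perm (Fin 2)), l.Perm l' → l.prod = l'.prod := fun l l' h =>
    h.prod_eq' (List.pairwise_of_forall hcomm)
  have hset : prodSet u = {comp u} := by
    ext g
    simp only [prodSet, rearrangements, Set.mem_image, Set.mem_ofPred_eq, Set.mem_singleton_iff]
    constructor
    · rintro ⟨l, hl, rfl⟩
      rw [comp_eq_prod_reverse, comp_eq_prod_reverse]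
      exact hprod _ _ ((List.reverse_perm l).trans (hl.trans (List.reverse_perm u).symm))
    · rintro rfl
      exact ⟨u, List.Perm.refl u, rfl⟩
  refine ⟨?_, ?_⟩
  · have hsign : ∀ g : Perm (Fin 2), (∀ h, h = g ↔ Perm.sign h = 1) ∨
        (∀ h, h = g ↔ ¬ Perm.sign h = 1) := by decide
    unfold PermComplete
    rw [hset]
    refine (hsign (comp u)).imp (fun h => ?_) fun h => ?_ <;> ext g
    · rw [Set.mem_singleton_iff, h, SetLike.mem_coe, Perm.mem_alternatingGroup]
    · rw [Set.mem_singleton_iff, h, Set.mem_compl_iff, SetLike.mem_coe, Perm.mem_alternatingGroup]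
  · rw [conjInvariant_iff]
    intro l l' hl hl'
    rw [hprod l l' (hl.trans hl'.symm)]

end PermSeq

/-! ### The general case, component by component -/

namespace LooplessMultigraph

variable {V : Type*} [Fintype V] [DecidableEq V]

/-- If `x` is also joined to the third vertex, `y` cannot be, as this would close a triangle. This
reconciles a simple multiedge in the connected case with a simple multitwig in the general one. -/
theorem isMultitwig_or_isMultitwig_of_card_three (hV : Fintype.card V = 3)
    {G : LooplessMultigraph V} (ha : G.toSimpleGraph.IsAcyclic) {x y : V} (h : G.IsMultiedge x y) :
    G.IsMultitwig x y ∨ G.IsMultitwig y x := by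
  have hadj : G.toSimpleGraph.Adj x y := h
  obtain ⟨z, hxz, hyz, hall⟩ := PermSeq.exists_third hV hadj.ne
  by_cases hz : G.toSimpleGraph.Adj x z
  · right
    refine Set.eq_singleton_iff_unique_mem.2 ⟨hadj.symm, fun v hv => ?_⟩
    have hv' : G.toSimpleGraph.Adj y v := hv
    rcases hall v with rfl | rfl | rfl
    · rfl
    · exact absurd rfl hv'.ne
    · refine absurd (ha.eq_snd_of_adj_start
        (p := SimpleGraph.Walk.cons hz (SimpleGraph.Walk.cons hv'.symm SimpleGraph.Walk.nil))
        ?_ hadj (by simp)) hyz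
      simp [SimpleGraph.Walk.isPath_def, hadj.ne, hxz, hyz.symm]
  · left
    refine Set.eq_singleton_iff_unique_mem.2 ⟨hadj, fun v hv => ?_⟩
    have hv' : G.toSimpleGraph.Adj x v := hv
    rcases hall v with rfl | rfl | rfl
    · exact absurd rfl hv'.ne
    · rfl
    · exact absurd hv' hz

end LooplessMultigraph

namespace PermSeq

variable {V : Type*} [Fintype V] [DecidableEq V]

omit [Fintype V] [DecidableEq V] in
theorem disjoint_list_prod {l l' : List (Perm V)} (h : ∀ t ∈ l, ∀ t' ∈ l', Perm.Disjoint t t') :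
    Perm.Disjoint l.prod l'.prod :=
  Perm.disjoint_prod_right _ fun t' ht' =>
    (Perm.disjoint_prod_right _ fun t ht => (h t ht t' ht').symm).symm

omit [Fintype V] [DecidableEq V] in
theorem prod_eq_prod_filter_mul_prod_filter_not (p : Perm V → Prop) [DecidablePred p] :
    ∀ {l : List (Perm V)}, (∀ t ∈ l, ∀ t' ∈ l, p t → ¬ p t' → Perm.Disjoint t t') →
      l.prod = (l.filter (fun t => p t)).prod * (l.filter (fun t => ¬ p t)).prod
  | [], _ => by simp
  | t :: l, h => by
    have ih := prod_eq_prod_filter_mul_prod_filter_not p (l := l) fun a ha b hb =>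
      h a (List.mem_cons_of_mem _ ha) b (List.mem_cons_of_mem _ hb)
    by_cases hp : p t
    · simp [hp, ih, mul_assoc]
    · have hc : Commute t (l.filter (fun t => p t)).prod := by
        refine (Perm.disjoint_prod_right _ fun a ha => ?_).commute
        have := List.mem_filter.1 ha
        exact (h a (List.mem_cons_of_mem _ this.1) t List.mem_cons_self
          (by simpa using this.2) hp).symm
      simp only [List.prod_cons, ih, hp, List.filter_cons, not_false_eq_true, decide_true,
        decide_false, if_true]
      simp only [Bool.false_eq_true, if_false]
      rw [← mul_assoc, hc.eq, mul_assoc]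

/-- Terms with different labels are disjoint, so the product sorts into one factor for each label
and cycle types add. -/
theorem cycleType_prod_eq_sum {κ : Type*} [DecidableEq κ] (k : Perm V → κ) (s : Finset κ) :
    ∀ {l : List (Perm V)}, (∀ t ∈ l, k t ∈ s) →
      (∀ t ∈ l, ∀ t' ∈ l, k t ≠ k t' → Perm.Disjoint t t') →
      l.prod.cycleType = ∑ i ∈ s, (l.filter (fun t => k t = i)).prod.cycleType := by
  induction s using Finset.induction_on with
  | empty =>
    intro l hs _
    have : l = [] := List.eq_nil_iff_forall_not_mem.2 fun t ht => by simpa using hs t ht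
    simp [this]
  | insert a s ha ih =>
    intro l hs hd
    rw [Finset.sum_insert ha,
      prod_eq_prod_filter_mul_prod_filter_not (fun t => k t = a) (l := l)
        fun t ht t' ht' e e' => hd t ht t' ht' fun h => e' (h ▸ e),
      Perm.Disjoint.cycleType_mul]
    · congr 1
      rw [ih]
      · refine Finset.sum_congr rfl fun i hi => ?_
        rw [List.filter_filter]
        congr 2
        refine List.filter_congr fun t _ => ?_
        have : i ≠ a := fun h => ha (h ▸ hi)
        by_cases e : k t = i
        · simp [e, this]
        · simp [e]
      · intro t ht
        have := List.mem_filter.1 ht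
        simpa [show k t ≠ a by simpa using this.2] using hs t this.1
      · intro t ht t' ht'
        exact hd t (List.mem_filter.1 ht).1 t' (List.mem_filter.1 ht').1
    · refine disjoint_list_prod fun t ht t' ht' => ?_
      have h1 := List.mem_filter.1 ht
      have h2 := List.mem_filter.1 ht'
      refine hd t h1.1 t' h2.1 fun h => ?_
      simp only [decide_eq_true_eq] at h1 h2
      exact h2.2 (h ▸ h1.2)

theorem conjInvariant_iff_forall_filter {κ : Type*} [Fintype κ] [DecidableEq κ] (k : Perm V → κ)
    {u : List (Perm V)} (hd : ∀ t ∈ u, ∀ t' ∈ u, k t ≠ k t' → Perm.Disjoint t t') :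
    ConjInvariant u ↔ ∀ i, ConjInvariant (u.filter (fun t => k t = i)) := by
  simp only [conjInvariant_iff, Perm.isConj_iff_cycleType_eq]
  constructor
  · intro h i l l' hl hl'
    -- The terms with other labels are kept in one fixed order; their cycle type is a common summand
    -- and cancels.
    set r := u.filter (fun t => ¬ k t = i)
    have hu : (u.filter (fun t => k t = i) ++ r).Perm u := by
      simpa [r] using List.filter_append_perm (fun t => decide (k t = i)) u
    have key : ∀ {m : List (Perm V)}, m.Perm (u.filter (fun t => k t = i)) →
        (m ++ r).prod.cycleType = m.prod.cycleType + r.prod.cycleType := by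
      intro m hm
      rw [List.prod_append, Perm.Disjoint.cycleType_mul]
      refine disjoint_list_prod fun t ht t' ht' => ?_
      have h1 := List.mem_filter.1 (hm.mem_iff.1 ht)
      have h2 := List.mem_filter.1 ht'
      refine hd t h1.1 t' h2.1 fun h => ?_
      simp only [decide_eq_true_eq] at h1 h2
      exact h2.2 (h ▸ h1.2)
    have := h (l ++ r) (l' ++ r) ((hl.append_right r).trans hu) ((hl'.append_right r).trans hu)
    rwa [key hl, key hl', add_left_inj] at this
  · intro h l l' hl hl'
    have key : ∀ {m : List (Perm V)}, m.Perm u →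
        m.prod.cycleType = ∑ i, (m.filter (fun t => k t = i)).prod.cycleType := fun hm =>
      cycleType_prod_eq_sum k Finset.univ (fun _ _ => Finset.mem_univ _) fun t ht t' ht' =>
        hd t (hm.mem_iff.1 ht) t' (hm.mem_iff.1 ht')
    rw [key hl, key hl']
    exact Finset.sum_congr rfl fun i _ => h i _ _ (hl.filter _) (hl'.filter _)

theorem exists_component_of_mem {u : List (Perm V)} (hs : Transpositional u) {t : Perm V}
    (ht : t ∈ u) : ∃ C : (transpositionalMultigraph u).toSimpleGraph.ConnectedComponent,
      ∀ x, t x ≠ x → x ∈ C.supp := by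
  obtain ⟨a, b, hab, rfl⟩ := hs t ht
  refine ⟨SimpleGraph.connectedComponentMk _ a, fun x hx => ?_⟩
  have hadj : (transpositionalMultigraph u).toSimpleGraph.Adj a b :=
    transpositionalMultigraph_adj.2 ⟨hab, ht⟩
  rw [SimpleGraph.ConnectedComponent.mem_supp_iff, SimpleGraph.ConnectedComponent.eq]
  by_cases h1 : x = a
  · rw [h1]
  by_cases h2 : x = b
  · rw [h2]; exact hadj.symm.reachable
  exact absurd (swap_apply_of_ne_of_ne h1 h2) hx

theorem conjInvariant_iff_forall_component {u : List (Perm V)} (hs : Transpositional u) :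
    ConjInvariant u ↔ ∀ C : (transpositionalMultigraph u).toSimpleGraph.ConnectedComponent,
      ConjInvariant (restrictTo u C.supp) := by
  classical
  -- A default component is needed to label the permutations outside `u`, so the empty vertex set is
  -- treated apart.
  rcases isEmpty_or_nonempty V with hV | hV
  · have : ∀ w : List (Perm V), ConjInvariant w := fun w g _ => Subsingleton.elim g _ ▸ IsConj.refl _
    exact ⟨fun _ C => this _, fun _ => this _⟩
  have : Nonempty (transpositionalMultigraph u).toSimpleGraph.ConnectedComponent :=
    hV.map fun v => SimpleGraph.connectedComponentMk _ v
  choose! k hk using fun t (ht : t ∈ u) => exists_component_of_mem hs ht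
  have huniq : ∀ {C D : (transpositionalMultigraph u).toSimpleGraph.ConnectedComponent} {x},
      x ∈ C.supp → x ∈ D.supp → C = D := fun h1 h2 => by
    rw [SimpleGraph.ConnectedComponent.mem_supp_iff] at h1 h2
    exact h1.symm.trans h2
  -- A transposition moves some point, so its support lies in one component only.
  have hr : ∀ C, restrictTo u C.supp = u.filter (fun t => k t = C) := fun C => by
    refine List.filter_congr fun t ht => ?_
    simp only [decide_eq_decide]
    refine ⟨fun h => ?_, fun h => h ▸ hk t ht⟩
    obtain ⟨a, b, hab, e⟩ := hs t ht
    have ha : t a ≠ a := by rw [e, swap_apply_left]; exact hab.symm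
    exact huniq (hk t ht a ha) (h ha)
  simp only [hr]
  have := Fintype.ofFinite (transpositionalMultigraph u).toSimpleGraph.ConnectedComponent
  refine conjInvariant_iff_forall_filter k fun t ht t' ht' hne x => ?_
  by_contra! h
  exact hne (huniq (hk t ht x h.1) (hk t' ht' x h.2))

/-- Extension by the identity preserves cycle types, and a rearrangement of extended terms is an
extended rearrangement. -/
theorem conjInvariant_map_ofSubtype_iff {S : Set V} [DecidablePred (· ∈ S)] {w : List (Perm S)} :
    ConjInvariant (w.map Perm.ofSubtype) ↔ ConjInvariant w := by
  have key : ∀ m : List (Perm S), (m.map Perm.ofSubtype).prod.cycleType = m.prod.cycleType := by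
    intro m
    rw [← map_list_prod, Perm.cycleType_ofSubtype]
  simp only [conjInvariant_iff, Perm.isConj_iff_cycleType_eq]
  constructor
  · intro h l l' hl hl'
    have := h _ _ (hl.map _) (hl'.map _)
    rwa [key, key] at this
  · intro h l l' hl hl'
    have hrange : ∀ {m : List (Perm V)}, m.Perm (w.map Perm.ofSubtype) →
        m ∈ Set.range (List.map (Perm.ofSubtype (p := (· ∈ S)))) := fun hm => by
      rw [Set.range_list_map]
      intro t ht
      obtain ⟨s, -, rfl⟩ := List.mem_map.1 (hm.mem_iff.1 ht)
      exact ⟨s, rfl⟩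
    obtain ⟨m, rfl⟩ := hrange hl
    obtain ⟨m', rfl⟩ := hrange hl'
    rw [List.map_perm_map_iff Perm.ofSubtype_injective] at hl hl'
    rw [key, key]
    exact h _ _ hl hl'

omit [Fintype V] in
theorem exists_eq_map_ofSubtype {S : Set V} [DecidablePred (· ∈ S)] :
    ∀ {u : List (Perm V)}, Transpositional u → (∀ t ∈ u, ∀ x, t x ≠ x → x ∈ S) →
      ∃ w : List (Perm S), Transpositional w ∧ u = w.map Perm.ofSubtype
  | [], _, _ => ⟨[], by simp [Transpositional], rfl⟩
  | t :: u, hs, h => by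
    obtain ⟨w, hw, e⟩ := exists_eq_map_ofSubtype (u := u)
      (fun t ht => hs t (List.mem_cons_of_mem _ ht))
      fun t ht => h t (List.mem_cons_of_mem _ ht)
    obtain ⟨a, b, hab, rfl⟩ := hs t List.mem_cons_self
    have ha : a ∈ S := h _ List.mem_cons_self a (by simpa using hab.symm)
    have hb : b ∈ S := h _ List.mem_cons_self b (by simpa using hab)
    refine ⟨swap ⟨a, ha⟩ ⟨b, hb⟩ :: w, ?_, ?_⟩
    · intro t ht
      rcases List.mem_cons.1 ht with rfl | ht
      · exact ⟨_, _, by simpa using hab, rfl⟩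
      · exact hw t ht
    · rw [List.map_cons, Perm.ofSubtype_swap_eq, e]

theorem transpositionalMultigraph_induce {S : Set V} [DecidablePred (· ∈ S)] {w : List (Perm S)} :
    (transpositionalMultigraph (w.map Perm.ofSubtype)).induce S = transpositionalMultigraph w := by
  simp only [transpositionalMultigraph, LooplessMultigraph.induce, LooplessMultigraph.mk.injEq]
  funext x y
  rw [← Perm.ofSubtype_swap_eq, List.count_map_of_injective _ _ Perm.ofSubtype_injective]
  simp only [Subtype.ext_iff]

/-- The terms of one component are pulled back to its own vertex set, where the multigraph is
connected and the connected case applies. -/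
theorem exists_restrictTo_eq_map {u : List (Perm V)} (hs : Transpositional u)
    (C : (transpositionalMultigraph u).toSimpleGraph.ConnectedComponent)
    [DecidablePred (· ∈ C.supp)] :
    ∃ w : List (Perm C.supp), Transpositional w ∧ (transpositionalMultigraph w).Connected ∧
      restrictTo u C.supp = w.map Perm.ofSubtype := by
  classical
  have hmem : ∀ {t}, t ∈ restrictTo u C.supp ↔ t ∈ u ∧ {x | t x ≠ x} ⊆ C.supp := by
    intro t; simp [restrictTo]
  obtain ⟨w, hw, e⟩ := exists_eq_map_ofSubtype (u := restrictTo u C.supp) (S := C.supp)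
    (fun t ht => hs t (hmem.1 ht).1) fun t ht x hx => (hmem.1 ht).2 hx
  refine ⟨w, hw, ?_, e⟩
  refine SimpleGraph.Connected.mono ?_ C.connected_toSimpleGraph
  intro x y hxy
  have hadj : (transpositionalMultigraph u).toSimpleGraph.Adj x y := hxy
  obtain ⟨hne, hin⟩ := transpositionalMultigraph_adj.1 hadj
  refine transpositionalMultigraph_adj.2 ⟨fun h => hne (h ▸ rfl), ?_⟩
  have : swap (x : V) y ∈ restrictTo u C.supp := by
    refine hmem.2 ⟨hin, fun z hz => ?_⟩
    by_cases h1 : z = x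
    · rw [h1]; exact x.2
    by_cases h2 : z = y
    · rw [h2]; exact y.2
    exact absurd (swap_apply_of_ne_of_ne h1 h2) hz
  rw [e, ← Perm.ofSubtype_swap_eq] at this
  exact (List.mem_map_of_injective Perm.ofSubtype_injective).1 this

theorem conjInvariant_restrictTo_iff_of_ncard_three {u : List (Perm V)} (hs : Transpositional u)
    (C : (transpositionalMultigraph u).toSimpleGraph.ConnectedComponent)
    (hC : C.supp.ncard = 3) :
    ConjInvariant (restrictTo u C.supp) ↔ Odd (restrictTo u C.supp).length ∨
      (((transpositionalMultigraph (restrictTo u C.supp)).induce C.supp).IsMultitree ∧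
        ∃ x y, ((transpositionalMultigraph (restrictTo u C.supp)).induce C.supp).IsMultitwig x y ∧
          ((transpositionalMultigraph (restrictTo u C.supp)).induce
            C.supp).IsSimpleMultiedge x y) := by
  classical
  obtain ⟨w, hw, hc, e⟩ := exists_restrictTo_eq_map hs C
  have hcard : Fintype.card C.supp = 3 := by rw [← Nat.card_eq_fintype_card]; exact hC
  rw [e, conjInvariant_map_ofSubtype_iff, List.length_map, transpositionalMultigraph_induce,
    conjInvariant_iff_of_card_three hcard hw hc]
  refine or_congr_right (and_congr_right fun ht => ?_)
  refine ⟨fun ⟨x, y, h⟩ => ?_, fun ⟨x, y, _, h⟩ => ⟨x, y, h⟩⟩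
  rcases LooplessMultigraph.isMultitwig_or_isMultitwig_of_card_three hcard ht.isAcyclic
    (show (transpositionalMultigraph w).IsMultiedge x y from one_pos.trans_eq h.symm) with h' | h'
  · exact ⟨x, y, h', h⟩
  · exact ⟨y, x, h', ((transpositionalMultigraph w).symm y x).trans h⟩

theorem conjInvariant_restrictTo_iff_of_four_le_ncard {u : List (Perm V)} (hs : Transpositional u)
    (C : (transpositionalMultigraph u).toSimpleGraph.ConnectedComponent)
    (hC : 4 ≤ C.supp.ncard) :
    ConjInvariant (restrictTo u C.supp) ↔
      ((transpositionalMultigraph (restrictTo u C.supp)).induce C.supp).IsMultitree ∧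
      ((transpositionalMultigraph (restrictTo u C.supp)).induce C.supp).NonsimpleDisjoint ∧
      ((transpositionalMultigraph (restrictTo u C.supp)).induce C.supp).EvenMultiedgesAreTwigs := by
  classical
  obtain ⟨w, hw, hc, e⟩ := exists_restrictTo_eq_map hs C
  have hcard : 4 ≤ Fintype.card C.supp := by rw [← Nat.card_eq_fintype_card]; exact hC
  rw [e, conjInvariant_map_ofSubtype_iff, transpositionalMultigraph_induce,
    conjInvariant_iff_of_four_le_card hcard hw hc]

end PermSeq

theorem mainTheorem1 (n : ℕ) (u : List (Equiv.Perm (Fin n))) (hu : PermSeq.Transpositional u) :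
    -- the connected case
    ((transpositionalMultigraph u).Connected →
      (n = 2 → PermSeq.PermComplete u ∧ PermSeq.ConjInvariant u) ∧
      (n = 3 →
        (PermSeq.ConjInvariant u ↔
          Odd u.length ∨
            ((transpositionalMultigraph u).IsMultitree ∧
              ∃ x y, (transpositionalMultigraph u).IsSimpleMultiedge x y))) ∧
      (4 ≤ n →
        (PermSeq.ConjInvariant u ↔
          (transpositionalMultigraph u).IsMultitree ∧
            (transpositionalMultigraph u).NonsimpleDisjoint ∧
            (transpositionalMultigraph u).EvenMultiedgesAreTwigs))) ∧
    -- the general case, component by component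
    (3 ≤ n →
      (PermSeq.ConjInvariant u ↔
        ∀ C : (transpositionalMultigraph u).toSimpleGraph.ConnectedComponent,
          PermSeq.ConjInvariant (PermSeq.restrictTo u C.supp)) ∧
      (∀ C : (transpositionalMultigraph u).toSimpleGraph.ConnectedComponent,
        C.supp.ncard = 3 →
          (PermSeq.ConjInvariant (PermSeq.restrictTo u C.supp) ↔
            Odd (PermSeq.restrictTo u C.supp).length ∨
              (((transpositionalMultigraph (PermSeq.restrictTo u C.supp)).induce
                  C.supp).IsMultitree ∧
                ∃ x y,
                  ((transpositionalMultigraph (PermSeq.restrictTo u C.supp)).induce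
                    C.supp).IsMultitwig x y ∧
                  ((transpositionalMultigraph (PermSeq.restrictTo u C.supp)).induce
                    C.supp).IsSimpleMultiedge x y))) ∧
      (∀ C : (transpositionalMultigraph u).toSimpleGraph.ConnectedComponent,
        4 ≤ C.supp.ncard →
          (PermSeq.ConjInvariant (PermSeq.restrictTo u C.supp) ↔
            ((transpositionalMultigraph (PermSeq.restrictTo u C.supp)).induce
                C.supp).IsMultitree ∧
              ((transpositionalMultigraph (PermSeq.restrictTo u C.supp)).induce
                C.supp).NonsimpleDisjoint ∧
              ((transpositionalMultigraph (PermSeq.restrictTo u C.supp)).induce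
                C.supp).EvenMultiedgesAreTwigs))) := by
  refine ⟨fun hc => ⟨?_, fun hn => ?_, fun hn => ?_⟩, fun _ => ⟨?_, fun C hC => ?_, fun C hC => ?_⟩⟩
  · rintro rfl
    exact PermSeq.permComplete_and_conjInvariant_fin_two u
  · exact PermSeq.conjInvariant_iff_of_card_three (by simpa using hn) hu hc
  · exact PermSeq.conjInvariant_iff_of_four_le_card (by simpa using hn) hu hc
  · exact PermSeq.conjInvariant_iff_forall_component hu
  · exact PermSeq.conjInvariant_restrictTo_iff_of_ncard_three hu C hC
  · exact PermSeq.conjInvariant_restrictTo_iff_of_four_le_ncard hu C hC
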